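/- Let $G$ be a topological group, $T\le G$ a closed abelian subgroup, $G/T$ the space of left cosets, and $X$ a CW complex. $[X,Y]$ denotes the set of free homotopy classes of continuous maps $X\to Y$; $[X,G]$ is a group under pointwise multiplication, and it acts on $[X,G/T]$ by $(v\cdot u)(x)=v(x)\,u(x)$. Let $EG=G*G*\cdots$ be Milnor's infinite join: its points are the sequences $(t_ig_i)_{i\ge 0}$ with $t_i\ge 0$, almost all $t_i=0$, $\sum_i t_i=1$, and $g_i\in G$ (disregarded when $t_i=0$); it carries the coarsest topology for which all maps $t_i:EG\to\mathbb R$ and $g_i:\{t_i\ne 0\}\to G$ are continuous, and $G$ acts on it from the right by $(t_ig_i)_i\cdot g=(t_i\,g_ig)_i$. Put $BG=EG/G$ and $BT=EG/T$, with the quotient topologies, and let $\pi:BT\to BG$ be the map induced by the inclusion $T\hookrightarrow G$. Fix a point $e\in EG$, let $j:G/T\to BT$, $gT\mapsto [e\cdot g]$, be the inclusion of the fibre of $\pi$ over $[e]$, and let $h:[X,G/T]\to[X,BT]$ be composition with $j$. Let $\kappa:G/T\times T\to G$ be the continuous map $\kappa(gT,t)=gtg^{-1}$, and for $u:X\to G/T$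 let $\kappa_u:[X,T]\to[X,G]$ be the group homomorphism induced by $v\mapsto\kappa\circ(u\times v)$, i.e. $\kappa_u(v)(x)=\kappa(u(x),v(x))$. Then \[ [X,T]\xrightarrow{\ \kappa_u\ }[X,G]\longrightarrow[X,G/T]\xrightarrow{\ h\ }[X,BT]\xrightarrow{\ \pi_*\ }[X,BG] \] is "exact" in the following sense. (1) A map $f:X\to BT$ lifts up to homotopy to $G/T$ (that is, $f\simeq j\circ u$ for some $u:X\to G/T$) if and only if $\pi\circ f$ is null-homotopic. (2) The orbits of the action of $[X,G]$ on $[X,G/T]$ are exactly the (non-empty) fibres of $h$. (3) For every $u:X\to G/T$ the image of $\kappa_u$ is contained in the stabilizer of $[u]$ in $[X,G]$. If $G\to G/T$ is a locally trivial principal $T$-bundle, i.e. has a continuous section over some neighbourhood of the identity coset (as is the case for every Lie group $G$ and closed subgroup $T$), then the stabilizer of $[u]$ is equal to the image of $\kappa_u$. -/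

import Mathlib

open Topology

noncomputable section

namespace BundleSeq

/-! ### Homotopy classes of maps -/

section HomotopyClasses

variable (X : Type*) (Y : Type*) [TopologicalSpace X] [TopologicalSpace Y]

/-- Free homotopy of continuous maps `X → Y`, as an equivalence relation. -/
def homotopySetoid : Setoid C(X, Y) :=
  ⟨ContinuousMap.Homotopic, ContinuousMap.Homotopic.equivalence⟩

/-- The set `[X, Y]` of free homotopy classes of continuous maps `X → Y`. -/
def HClass : Type _ := Quotient (homotopySetoid X Y)

end HomotopyClasses

section Functoriality

variable {X Y Z : Type*} [TopologicalSpace X] [TopologicalSpace Y] [TopologicalSpace Z]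

/-- The homotopy class of a map. -/
def HClass.mk (f : C(X, Y)) : HClass X Y := Quotient.mk (homotopySetoid X Y) f

theorem HClass.mk_eq_mk {f g : C(X, Y)} : HClass.mk f = HClass.mk g ↔ f.Homotopic g :=
  Quotient.eq (r := homotopySetoid X Y)

theorem HClass.ind {p : HClass X Y → Prop} (h : ∀ f, p (HClass.mk f)) (a : HClass X Y) : p a :=
  Quotient.ind h a

/-- Composition with `j : Y → Z`, as a map `[X, Y] → [X, Z]`. -/
def HClass.postcomp (j : C(Y, Z)) : HClass X Y → HClass X Z :=
  Quotient.map (fun f => j.comp f) (fun _ _ h => (ContinuousMap.Homotopic.refl j).comp h)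

end Functoriality

/-! ### The group `[X, G]` and its action on `[X, G/T]` -/

section GroupStructure

variable {X : Type*} [TopologicalSpace X] {G : Type*} [Group G] [TopologicalSpace G]
  [IsTopologicalGroup G]

/-- The pointwise group structure on `[X, G]`. -/
instance : Group (HClass X G) where
  mul := Quotient.map₂ (fun f g => f * g) (by
    rintro f f' ⟨F⟩ g g' ⟨H⟩
    exact ⟨⟨F.toContinuousMap * H.toContinuousMap, fun x => by simp, fun x => by simp⟩⟩)
  one := HClass.mk 1
  inv := Quotient.map (fun f => f⁻¹) (by
    rintro f f' ⟨F⟩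
    exact ⟨⟨F.toContinuousMap⁻¹, fun x => by simp, fun x => by simp⟩⟩)
  mul_assoc a b c := by
    induction a using HClass.ind
    induction b using HClass.ind
    induction c using HClass.ind
    exact congrArg HClass.mk (mul_assoc _ _ _)
  one_mul a := by
    induction a using HClass.ind
    exact congrArg HClass.mk (one_mul _)
  mul_one a := by
    induction a using HClass.ind
    exact congrArg HClass.mk (mul_one _)
  inv_mul_cancel a := by
    induction a using HClass.ind
    exact congrArg HClass.mk (inv_mul_cancel _)

variable {T : Subgroup G}

/-- The pointwise product `x ↦ v x • u x` of `v : X → G` and `u : X → G/T`. -/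
def mapSmul (v : C(X, G)) (u : C(X, G ⧸ T)) : C(X, G ⧸ T) :=
  ⟨fun x => v x • u x, v.continuous.smul u.continuous⟩

/-- The action of `[X, G]` on `[X, G/T]` induced by the left translation action of `G` on the
space `G/T` of left cosets. -/
instance : MulAction (HClass X G) (HClass X (G ⧸ T)) where
  smul := Quotient.map₂ mapSmul (by
    rintro f f' ⟨F⟩ g g' ⟨H⟩
    exact ⟨⟨mapSmul F.toContinuousMap H.toContinuousMap, fun x => by simp [mapSmul],
      fun x => by simp [mapSmul]⟩⟩)
  one_smul a := by
    induction a using HClass.ind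
    exact congrArg HClass.mk (ContinuousMap.ext fun x => one_smul G _)
  mul_smul a b c := by
    induction a using HClass.ind
    induction b using HClass.ind
    induction c using HClass.ind
    exact congrArg HClass.mk (ContinuousMap.ext fun x => mul_smul _ _ _)

end GroupStructure

/-! ### The map `κ` and the homomorphisms `κ_u` -/

section Kappa

variable {G : Type*} [Group G] (T : Subgroup G) [IsMulCommutative T]

/-- `κ (gT, t) = g t g⁻¹`; it is well defined because `T` is abelian. -/
def kappaFun (p : (G ⧸ T) × T) : G :=
  Quotient.liftOn' p.1 (fun g => g * (p.2 : G) * g⁻¹) (by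
    intro a b h
    rw [QuotientGroup.leftRel_apply] at h
    have hc : (a⁻¹ * b) * (p.2 : G) = (p.2 : G) * (a⁻¹ * b) :=
      congrArg Subtype.val (IsMulCommutative.is_comm.comm (⟨a⁻¹ * b, h⟩ : T) p.2)
    have hb : b = a * (a⁻¹ * b) := by group
    have : b * (p.2 : G) = a * (p.2 : G) * (a⁻¹ * b) := by
      rw [mul_assoc a, ← hc]; group
    change a * (p.2 : G) * a⁻¹ = b * (p.2 : G) * b⁻¹
    rw [this]; group)

theorem kappaFun_mk (g : G) (t : T) : kappaFun T ((g : G ⧸ T), t) = g * t * g⁻¹ := rfl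

theorem kappaFun_mul (x : G ⧸ T) (s t : T) :
    kappaFun T (x, s * t) = kappaFun T (x, s) * kappaFun T (x, t) := by
  induction x using QuotientGroup.induction_on
  simp only [kappaFun_mk, Subgroup.coe_mul]
  group

variable [TopologicalSpace G] [IsTopologicalGroup G]

/-- The continuous map `κ : G/T × T → G`, `κ (gT, t) = g t g⁻¹`. -/
def kappa : C((G ⧸ T) × T, G) where
  toFun := kappaFun T
  continuous_toFun := by
    have hq : IsOpenQuotientMap (Prod.map (QuotientGroup.mk : G → G ⧸ T) (id : T → T)) :=
      QuotientGroup.isOpenQuotientMap_mk.prodMap IsOpenQuotientMap.id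
    rw [← hq.continuous_comp_iff]
    change Continuous fun p : G × T => p.1 * (p.2 : G) * p.1⁻¹
    fun_prop

variable {X : Type*} [TopologicalSpace X]

/-- For `u : X → G/T`, the homomorphism `κ_u : [X, T] → [X, G]` that sends the class of `v` to the
class of `x ↦ κ (u x, v x)`. -/
def kappaHom (u : C(X, G ⧸ T)) : HClass X T →* HClass X G :=
  MonoidHom.mk'
    (Quotient.map (fun v : C(X, T) => (kappa T).comp (u.prodMk v)) (fun _ _ h =>
      (ContinuousMap.Homotopic.refl _).comp ((ContinuousMap.Homotopic.refl u).prodMk h)))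
    (by
      intro a b
      induction a using HClass.ind
      induction b using HClass.ind
      exact congrArg HClass.mk (ContinuousMap.ext fun x => kappaFun_mul T _ _ _))

end Kappa

/-! ### Milnor's universal bundle and the spaces `BG` and `BT` -/

/-- The points of Milnor's space `EG`, the infinite join `G * G * ⋯`: sequences
`(t₀ g₀, t₁ g₁, …)` with barycentric coordinates `tᵢ ≥ 0`, almost all zero, of sum `1`, and
`gᵢ ∈ G` present only where `tᵢ ≠ 0`. -/
@[ext]
structure MilnorE (G : Type*) where
  /-- The barycentric coordinates `tᵢ`. -/
  weight : ℕ → ℝ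
  weight_nonneg : ∀ i, 0 ≤ weight i
  finite_support : (Function.support weight).Finite
  sum_weight : ∑ᶠ i, weight i = 1
  /-- The coordinates `gᵢ`, defined where `tᵢ ≠ 0`. -/
  coord : ∀ i, weight i ≠ 0 → G

section Milnor

variable {G : Type*}

/-- Milnor's topology on `EG`: the coarsest one for which all `tᵢ : EG → ℝ` and all
`gᵢ : {tᵢ ≠ 0} → G` are continuous (on open domains). -/
instance [TopologicalSpace G] : TopologicalSpace (MilnorE G) :=
  (⨅ i : ℕ, TopologicalSpace.induced (fun e : MilnorE G => e.weight i) inferInstance) ⊓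
    ⨅ i : ℕ, TopologicalSpace.generateFrom
      {S | ∃ U : Set G, IsOpen U ∧ S = {e : MilnorE G | ∃ h : e.weight i ≠ 0, e.coord i h ∈ U}}

variable [Group G]

/-- The right action of `G` on `EG`, `(tᵢ gᵢ)ᵢ · g = (tᵢ (gᵢ g))ᵢ`. -/
instance : MulAction Gᵐᵒᵖ (MilnorE G) where
  smul g e := { e with coord := fun i h => e.coord i h * g.unop }
  one_smul e := by
    change MilnorE.mk _ _ _ _ _ = _
    simp
  mul_smul a b e := by
    refine MilnorE.ext rfl (heq_of_eq (funext fun i => funext fun h => ?_))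
    exact (mul_assoc (e.coord i h) b.unop a.unop).symm

variable [TopologicalSpace G]

variable (G) in
/-- The classifying space `BG = EG/G`, with the quotient topology. -/
abbrev MilnorB : Type _ := Quotient (MulAction.orbitRel Gᵐᵒᵖ (MilnorE G))

/-- The space `BT = EG/T` for a subgroup `T` of `G`, with the quotient topology. -/
abbrev SubgroupB (T : Subgroup G) : Type _ := Quotient (MulAction.orbitRel T.op (MilnorE G))

/-- The map `π : BT = EG/T → EG/G = BG` induced by the inclusion of `T` in `G`. -/
def projB (T : Subgroup G) : C(SubgroupB T, MilnorB G) where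
  toFun := Quotient.map' id (by
    rintro a b ⟨t, rfl⟩
    exact ⟨(t : Gᵐᵒᵖ), rfl⟩)
  continuous_toFun := continuous_id.quotient_map' _

theorem continuous_orbit [IsTopologicalGroup G] (e : MilnorE G) :
    Continuous fun g : G => MulOpposite.op g • e := by
  refine continuous_inf_rng.2 ⟨continuous_iInf_rng.2 fun i => ?_, continuous_iInf_rng.2 fun i => ?_⟩
  · exact continuous_induced_rng.2 continuous_const
  · refine continuous_generateFrom_iff.2 ?_
    rintro _ ⟨U, hU, rfl⟩
    by_cases h : e.weight i ≠ 0
    · have : Continuous fun g : G => e.coord i h * g := by fun_prop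
      convert hU.preimage this using 1
      ext g
      exact ⟨fun ⟨_, h'⟩ => h', fun h' => ⟨h, h'⟩⟩
    · convert isOpen_empty using 1
      ext g
      exact ⟨fun ⟨h', _⟩ => h h', fun h' => h'.elim⟩

/-- The inclusion `G/T → BT`, `gT ↦ [e · g]`, of the fibre of `π : BT → BG` over the class of
`e ∈ EG`. -/
def fibreIncl [IsTopologicalGroup G] (T : Subgroup G) (e : MilnorE G) :
    C(G ⧸ T, SubgroupB T) where
  toFun := Quotient.lift
    (fun g : G => (Quotient.mk _ (MulOpposite.op g • e) : SubgroupB T)) (by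
      intro a b h
      have h' : a⁻¹ * b ∈ T := QuotientGroup.leftRel_apply.1 h
      refine Eq.symm (Quotient.sound ⟨⟨MulOpposite.op (a⁻¹ * b), h'⟩, ?_⟩)
      change MulOpposite.op (a⁻¹ * b) • MulOpposite.op a • e = _
      rw [smul_smul, ← MulOpposite.op_mul]
      simp)
  continuous_toFun := (continuous_quotient_mk'.comp (continuous_orbit e)).quotient_lift _

end Milnor

/-- The subgroup `T` has local cross-sections in `G`: over some neighbourhood of the identity coset
the projection `G → G/T` has a continuous section.  By translation such sections exist near every
coset, so this says that `G → G/T` is a locally trivial principal `T`-bundle. -/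
def HasLocalCrossSections {G : Type*} [Group G] [TopologicalSpace G] (T : Subgroup G) : Prop :=
  ∃ U ∈ 𝓝 ((1 : G) : G ⧸ T), ∃ s : G ⧸ T → G, ContinuousOn s U ∧ ∀ x ∈ U, (s x : G ⧸ T) = x

end BundleSeq

end

/-!
Each part of the theorem is the homotopy lifting property, for maps out of the CW complex `X`, of a
suitable locally trivial bundle:

* `π : BT → BG`, with fibre `G/T`, for the lifting criterion;
* `EG → BG`, with fibre `G`, for the statement that fibres of `h` are orbits;
* `G × G/T → G/T × G/T`, `(g, y) ↦ (y, g y)`, with fibre `T`, for the stabilizers.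

If `π ∘ f` is null-homotopic, then a lift of the null-homotopy deforms `f` into a fibre of `π`, and
as `EG` is path connected, this may be taken to be the fibre over `[e]`.  Given a homotopy `F` from
`j ∘ u'` to `j ∘ u`, the homotopy `π ∘ F` lifts to a homotopy in `EG` from the constant map `e` to
some `e · v`; comparing `F` with this lift gives a homotopy in `G/T` from `u'` to `v⁻¹ u`.
Conversely, `j ∘ (v u)` and `j ∘ u` are homotopic because `x ↦ e · v x` contracts in `EG`: the
finitely supported point `e` does not meet some factor of the infinite join, and so the map can be
contracted to the vertex `1` of that factor.  Finally, a homotopy from `u` to `v u` lifts along the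
third bundle to a homotopy of maps `X → G` from `1` to some `v'` with `v' u = v u`, and then
`v'⁻¹ v`, which is homotopic to `v`, is of the form `κ (u, t)`.

The local triviality that the lifting needs is `HasLocalTransport`: over small open sets, a point of
the total space can be moved continuously to any nearby fibre.  This gives the lifting of homotopies
over compact metric spaces (`HasLocalTransport.liftsUpTo_one`), then lifting over a ball relative to
its boundary (`HasLocalTransport.exists_lift_ball`), and hence, cell by cell
(`exists_continuous_of_cellwise_extension`), over CW complexes
(`HasLocalTransport.exists_homotopy_lift`).  As the unit interval is compact, a homotopy
`I × X → E` is the same as a map from `X` to the path space `C(I, E)`, so that the topology of the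
product `I × X` never has to be described by cells.
-/

noncomputable section

namespace BundleSeq

/-! ### Extension over the cells of a CW complex -/

section CellInduction

open Metric Set Topology.RelCWComplex

variable {X A : Type*} [TopologicalSpace X] [T2Space X] [TopologicalSpace A]

/-- A map that is continuous after composition with a characteristic map is continuous on the
closed cell: the closed ball is compact, so the characteristic map is a quotient map onto it. -/
theorem continuousOn_closedCell [CWComplex (univ : Set X)] {n : ℕ} (i : cell (univ : Set X) n)
    {L : X → A} (hL : ContinuousOn (L ∘ map n i) (closedBall 0 1)) :
    ContinuousOn L (closedCell n i) := by
  rw [continuousOn_iff_isClosed]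
  intro s hs
  obtain ⟨t, ht, hst⟩ := continuousOn_iff_isClosed.1 hL s hs
  refine ⟨map n i '' (t ∩ closedBall 0 1), ?_, ?_⟩
  · exact (((isCompact_closedBall _ _).inter_left ht).image_of_continuousOn
      ((continuousOn n i).mono inter_subset_right)).isClosed
  · rw [← hst]
    ext x
    constructor
    · rintro ⟨hx, z, hz, rfl⟩
      exact ⟨⟨z, ⟨hx, hz⟩, rfl⟩, z, hz, rfl⟩
    · rintro ⟨⟨z, ⟨hz, hz'⟩, rfl⟩, h⟩
      exact ⟨hz, h⟩

theorem continuous_of_continuousOn_cells [CWComplex (univ : Set X)] {L : X → A}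
    (hL : ∀ n (i : cell (univ : Set X) n), ContinuousOn (L ∘ map n i) (closedBall 0 1)) :
    Continuous L := by
  refine continuous_iff_isClosed.2 fun s hs => ?_
  refine (CWComplex.closed (univ : Set X) _ (subset_univ _)).2 fun n j => ?_
  obtain ⟨t, ht, hst⟩ := continuousOn_iff_isClosed.1 (continuousOn_closedCell j (hL n j)) s hs
  rw [hst]
  exact ht.inter isClosed_closedCell

/-- Extension over the `n`-cells of a partial solution of the problem to find a continuous `L` with
`L x ∈ R x`.  A partial solution is a total function, of which only the restriction to the
skeleton matters; its continuity is expressed on the cells. -/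
theorem exists_extension_skeletonLT_succ [CWComplex (univ : Set X)] (R : X → Set A)
    (hR : ∀ n (i : cell (univ : Set X) n) (a : (Fin n → ℝ) → A), ContinuousOn a (sphere 0 1) →
      (∀ z ∈ sphere (0 : Fin n → ℝ) 1, a z ∈ R (map n i z)) →
      ∃ a' : (Fin n → ℝ) → A, ContinuousOn a' (closedBall 0 1) ∧ EqOn a' a (sphere 0 1) ∧
        ∀ z ∈ closedBall (0 : Fin n → ℝ) 1, a' z ∈ R (map n i z))
    (n : ℕ) (L : X → A)
    (hc : ∀ m < n, ∀ i : cell (univ : Set X) m, ContinuousOn (L ∘ map m i) (closedBall 0 1))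
    (hm : ∀ x ∈ skeletonLT (univ : Set X) n, L x ∈ R x) :
    ∃ L' : X → A, EqOn L' L (skeletonLT (univ : Set X) n) ∧
      (∀ m < n + 1, ∀ i : cell (univ : Set X) m,
        ContinuousOn (L' ∘ map m i) (closedBall 0 1)) ∧
      ∀ x ∈ skeletonLT (univ : Set X) (n + 1 : ℕ), L' x ∈ R x := by
  classical
  have hsph : ∀ (i : cell (univ : Set X) n), ∀ z ∈ sphere (0 : Fin n → ℝ) 1,
      map n i z ∈ skeletonLT (univ : Set X) n := fun i z hz =>
    cellFrontier_subset_skeletonLT n i ⟨z, hz, rfl⟩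
  have ha : ∀ i : cell (univ : Set X) n, ContinuousOn (L ∘ map n i) (sphere 0 1) := by
    intro i
    obtain ⟨I, hI⟩ := CWComplex.mapsTo n i
    have : ContinuousOn L (⋃ m ∈ Finset.range n, ⋃ j ∈ I m, closedCell m j) := by
      refine ContinuousOn.mono (s := ⋃ p : (m : Finset.range n) × (I m : Finset _),
        closedCell (p.1 : ℕ) (p.2 : cell (univ : Set X) p.1)) ?_ ?_
      · refine (locallyFinite_of_finite _).continuousOn_iUnion (fun _ => isClosed_closedCell) ?_
        rintro ⟨⟨m, hm⟩, j⟩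
        exact continuousOn_closedCell _ (hc m (Finset.mem_range.1 hm) j)
      · intro x hx
        simp only [mem_iUnion] at hx ⊢
        obtain ⟨m, hm, j, hj, hx⟩ := hx
        exact ⟨⟨⟨m, hm⟩, ⟨j, hj⟩⟩, hx⟩
    refine this.comp ((RelCWComplex.continuousOn n i).mono sphere_subset_closedBall) ?_
    intro z hz
    have := hI hz
    simp only [mem_iUnion] at this
    obtain ⟨m, hm, j, hj, hx⟩ := this
    simp only [mem_iUnion]
    exact ⟨m, Finset.mem_range.2 hm, j, hj, hx⟩
  choose a' ha'c ha'e ha'm using fun i => hR n i (L ∘ map n i) (ha i)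
    fun z hz => hm _ (hsph i z hz)
  let L' : X → A := fun x =>
    if h : ∃ i : cell (univ : Set X) n, x ∈ openCell n i then a' h.choose ((map n h.choose).symm x)
    else L x
  have hnot : ∀ x ∈ skeletonLT (univ : Set X) n, ∀ i : cell (univ : Set X) n,
      x ∉ openCell n i := by
    intro x hx i hxi
    exact (disjoint_skeletonLT_openCell le_rfl (j := i)).le_bot ⟨hx, hxi⟩
  have hold : EqOn L' L (skeletonLT (univ : Set X) n) := by
    intro x hx
    have : ¬ ∃ i : cell (univ : Set X) n, x ∈ openCell n i := fun ⟨i, hi⟩ => hnot x hx i hi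
    simp only [L', dif_neg this]
  have hnew : ∀ (i : cell (univ : Set X) n), EqOn (L' ∘ map n i) (a' i) (closedBall 0 1) := by
    intro i z hz
    rw [← ball_union_sphere] at hz
    rcases hz with hz | hz
    · have hi : map n i z ∈ openCell n i := ⟨z, hz, rfl⟩
      have h : ∃ i' : cell (univ : Set X) n, map n i z ∈ openCell n i' := ⟨i, hi⟩
      have hch : h.choose = i := by
        by_contra hne
        have := disjoint_openCell_of_ne (C := (univ : Set X)) (i := h.choose) (j := i)
          (fun he => hne (by simpa using he))
        exact this.le_bot ⟨h.choose_spec, hi⟩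
      simp only [L', Function.comp, dif_pos h]
      rw [hch, (map n i).left_inv (by rwa [source_eq])]
    · rw [Function.comp, hold (hsph i z hz), ha'e i hz]
      rfl
  refine ⟨L', hold, ?_, ?_⟩
  · intro m hm i
    rcases Nat.lt_succ_iff_lt_or_eq.1 hm with hm | rfl
    · refine (hc m hm i).congr fun z hz => hold ?_
      refine skeletonLT_mono (Order.add_one_le_of_lt (by exact_mod_cast hm))
        (closedCell_subset_skeletonLT m i ⟨z, hz, rfl⟩)
    · exact (ha'c i).congr (hnew i)
  · intro x hx
    have hx' : x ∈ (skeletonLT (univ : Set X) n : Set X) ∪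
        ⋃ (j : cell (univ : Set X) n), closedCell n j := by
      rw [skeletonLT_union_iUnion_closedCell_eq_skeletonLT_succ]
      exact_mod_cast hx
    rcases hx' with hx | hx
    · rw [hold hx]
      exact hm x hx
    · obtain ⟨i, z, hz, rfl⟩ := mem_iUnion.1 hx
      have := hnew i hz
      simp only [Function.comp] at this
      rw [this]
      exact ha'm i z hz

/-- Cell-by-cell construction of a continuous map `L` subject to pointwise constraints
`L x ∈ R x`: it suffices to extend every solution over a sphere to the ball that it bounds. -/
theorem exists_continuous_of_cellwise_extension [CWComplex (univ : Set X)] [Nonempty A]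
    (R : X → Set A)
    (hR : ∀ n (i : cell (univ : Set X) n) (a : (Fin n → ℝ) → A), ContinuousOn a (sphere 0 1) →
      (∀ z ∈ sphere (0 : Fin n → ℝ) 1, a z ∈ R (map n i z)) →
      ∃ a' : (Fin n → ℝ) → A, ContinuousOn a' (closedBall 0 1) ∧ EqOn a' a (sphere 0 1) ∧
        ∀ z ∈ closedBall (0 : Fin n → ℝ) 1, a' z ∈ R (map n i z)) :
    ∃ L : X → A, Continuous L ∧ ∀ x, L x ∈ R x := by
  classical
  let Good (n : ℕ) (L : X → A) : Prop :=
    (∀ m < n, ∀ i : cell (univ : Set X) m, ContinuousOn (L ∘ map m i) (closedBall 0 1)) ∧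
      ∀ x ∈ skeletonLT (univ : Set X) n, L x ∈ R x
  have hstep : ∀ n (L : {L // Good n L}), ∃ L' : {L // Good (n + 1) L},
      EqOn L'.1 L.1 (skeletonLT (univ : Set X) n) := by
    rintro n ⟨L, hc, hm⟩
    obtain ⟨L', h1, h2, h3⟩ := exists_extension_skeletonLT_succ R hR n L hc hm
    exact ⟨⟨L', h2, h3⟩, h1⟩
  choose next hnext using hstep
  have h0 : Good 0 (fun _ => Classical.arbitrary A) := by
    refine ⟨fun m hm => absurd hm (Nat.not_lt_zero m), fun x hx => ?_⟩
    have : x ∈ (skeletonLT (univ : Set X) 0 : Set X) := by exact_mod_cast hx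
    rw [CWComplex.skeletonLT_zero_eq_empty] at this
    exact this.elim
  let F : ∀ n, {L // Good n L} := fun n => Nat.rec ⟨_, h0⟩ next n
  have hF : ∀ n m : ℕ, n ≤ m → EqOn (F m).1 (F n).1 (skeletonLT (univ : Set X) n) := by
    intro n m hnm
    induction m, hnm using Nat.le_induction with
    | base => exact fun _ _ => rfl
    | succ m hnm ih =>
      intro x hx
      rw [← ih hx]
      exact hnext m (F m) (skeletonLT_mono (by exact_mod_cast hnm) hx)
  have hex : ∀ x : X, ∃ n : ℕ, x ∈ skeletonLT (univ : Set X) n := by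
    intro x
    have : x ∈ ⋃ n : ℕ, (skeletonLT (univ : Set X) n : Set X) := by
      rw [iUnion_skeletonLT_eq_complex]; trivial
    exact mem_iUnion.1 this
  choose d hd using hex
  have hL : ∀ n : ℕ, ∀ x ∈ skeletonLT (univ : Set X) n, (F (d x)).1 x = (F n).1 x := by
    intro n x hx
    rcases le_total n (d x) with h | h
    · exact hF _ _ h hx
    · exact (hF _ _ h (hd x)).symm
  refine ⟨fun x => (F (d x)).1 x, ?_, fun x => (F (d x)).2.2 x (hd x)⟩
  refine continuous_of_continuousOn_cells fun n i => ?_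
  refine ((F (n + 1)).2.1 n (Nat.lt_succ_self n) i).congr fun z hz => hL (n + 1) _ ?_
  exact_mod_cast closedCell_subset_skeletonLT n i ⟨z, hz, rfl⟩

end CellInduction

/-! ### Homotopy lifting for maps with local transport -/

section HomotopyLifting

/-- A map `p : E → B` has *local transport* if over suitable neighbourhoods `V` of the points of
`B` there is a continuous rule `Γ y e` that moves a point `e` over `V` into the fibre over `y ∈ V`
and that fixes `e` for `y = p e`.  The trivializations `p⁻¹ V ≃ V × F` of a locally trivial bundle
give such rules.  `Γ` is a total function, and only its values over `V` matter. -/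
def HasLocalTransport {E B : Type*} [TopologicalSpace E] [TopologicalSpace B] (p : E → B) : Prop :=
  ∀ b, ∃ V ∈ 𝓝 b, ∃ Γ : B × E → E, ContinuousOn Γ (V ×ˢ (p ⁻¹' V)) ∧
    (∀ y ∈ V, ∀ e ∈ p ⁻¹' V, p (Γ (y, e)) = y) ∧ ∀ e ∈ p ⁻¹' V, Γ (p e, e) = e

variable {E B Z : Type*} [TopologicalSpace E] [TopologicalSpace B] {p : E → B}

/-- The homotopy `H`, stopped at time `σ z`, has a lift that starts at `f`. -/
def LiftsUpTo [TopologicalSpace Z] (p : E → B) (f : Z → E) (H : C(Z × ℝ, B)) (σ : Z → ℝ) : Prop :=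
  ∃ L : C(Z × ℝ, E), (∀ z t, p (L (z, t)) = H (z, min t (σ z))) ∧ ∀ z, L (z, 0) = f z

/-- A lift is prolonged from the time `σ` to the time `σ'` by transport along the homotopy, if these
times differ only over a closed set `C` and the part of the homotopy in question stays, for points
of `C`, in one set `V` with a transport rule. -/
theorem LiftsUpTo.extend [TopologicalSpace Z] {f : Z → E} {H : C(Z × ℝ, B)} {σ σ' : Z → ℝ}
    (hL : LiftsUpTo p f H σ) (hσ : Continuous σ) (hσ' : Continuous σ') (h0 : ∀ z, 0 ≤ σ z)
    (hle : ∀ z, σ z ≤ σ' z) {C : Set Z} (hC : IsClosed C) (heq : ∀ z ∉ C, σ' z = σ z)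
    {V : Set B} {Γ : B × E → E} (hΓ : ContinuousOn Γ (V ×ˢ (p ⁻¹' V)))
    (hΓp : ∀ y ∈ V, ∀ e ∈ p ⁻¹' V, p (Γ (y, e)) = y) (hΓe : ∀ e ∈ p ⁻¹' V, Γ (p e, e) = e)
    (hV : ∀ z ∈ C, ∀ t, σ z ≤ t → t ≤ σ' z → H (z, t) ∈ V) :
    LiftsUpTo p f H σ' := by
  classical
  obtain ⟨L, hLp, hLf⟩ := hL
  let S₂ : Set (Z × ℝ) := {y | y.1 ∈ C ∧ σ y.1 ≤ y.2}
  let S₁ : Set (Z × ℝ) := {y | y.2 ≤ σ y.1} ∪ {y | σ' y.1 = σ y.1}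
  let L' : Z × ℝ → E := fun y =>
    if y ∈ S₂ then Γ (H (y.1, min y.2 (σ' y.1)), L (y.1, σ y.1)) else L (y.1, min y.2 (σ y.1))
  have hS₂ : IsClosed S₂ := (hC.preimage continuous_fst).inter
    (isClosed_le (hσ.comp continuous_fst) continuous_snd)
  have hS₁ : IsClosed S₁ := (isClosed_le continuous_snd (hσ.comp continuous_fst)).union
    (isClosed_eq (hσ'.comp continuous_fst) (hσ.comp continuous_fst))
  have hpσ : ∀ z, p (L (z, σ z)) = H (z, σ z) := fun z => by rw [hLp, min_self]
  have hVσ : ∀ z ∈ C, L (z, σ z) ∈ p ⁻¹' V := fun z hz => by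
    rw [Set.mem_preimage, hpσ]
    exact hV z hz _ le_rfl (hle z)
  have hVt : ∀ y ∈ S₂, H (y.1, min y.2 (σ' y.1)) ∈ V := fun y hy =>
    hV _ hy.1 _ (le_min hy.2 (hle _)) (min_le_right _ _)
  have h₂ : ContinuousOn L' S₂ := by
    have : ContinuousOn (fun y : Z × ℝ => Γ (H (y.1, min y.2 (σ' y.1)), L (y.1, σ y.1))) S₂ := by
      refine hΓ.comp (Continuous.continuousOn (by fun_prop)) ?_
      exact fun y hy => ⟨hVt y hy, hVσ _ hy.1⟩
    exact this.congr fun y hy => if_pos hy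
  have h₁ : ContinuousOn L' S₁ := by
    have : Continuous (fun y : Z × ℝ => L (y.1, min y.2 (σ y.1))) := by fun_prop
    refine this.continuousOn.congr fun y hy => ?_
    by_cases h : y ∈ S₂
    · have h1 : min y.2 (σ' y.1) = σ y.1 := by
        rcases hy with hy | hy
        · rw [le_antisymm hy h.2]; exact min_eq_left (hle _)
        · rw [show σ' y.1 = σ y.1 from hy]; exact min_eq_right h.2
      simp only [L', if_pos h]
      rw [h1, min_eq_right h.2, ← hpσ, hΓe _ (hVσ _ h.1)]
    · exact if_neg h
  have hcov : S₁ ∪ S₂ = Set.univ := by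
    refine Set.eq_univ_of_forall fun y => ?_
    by_cases hc : y.1 ∈ C
    · rcases le_total y.2 (σ y.1) with h | h
      · exact Or.inl (Or.inl h)
      · exact Or.inr ⟨hc, h⟩
    · exact Or.inl (Or.inr (heq _ hc))
  have hcont : Continuous L' := by
    rw [← continuousOn_univ, ← hcov]
    exact h₁.union_of_isClosed h₂ hS₁ hS₂
  refine ⟨⟨L', hcont⟩, fun z t => ?_, fun z => ?_⟩
  · change p (L' (z, t)) = _
    by_cases h : (z, t) ∈ S₂
    · simp only [L', if_pos h]
      exact hΓp _ (hVt _ h) _ (hVσ _ h.1)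
    · simp only [L', if_neg h]
      rw [hLp, min_assoc, min_self]
      by_cases hc : z ∈ C
      · have : t < σ z := not_le.1 fun h' => h ⟨hc, h'⟩
        rw [min_eq_left this.le, min_eq_left (this.le.trans (hle z))]
      · rw [heq z hc]
  · change L' (z, 0) = _
    have hmem : (z, (0 : ℝ)) ∈ S₁ := Or.inl (h0 z)
    by_cases h : (z, (0 : ℝ)) ∈ S₂
    · have h1 : σ z = 0 := le_antisymm h.2 (h0 z)
      simp only [L', if_pos h]
      rw [min_eq_left (h1 ▸ hle z), ← hLf z]
      have := hΓe _ (hVσ z h.1)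
      rw [hpσ, h1] at this
      rwa [h1]
    · simp only [L', if_neg h]
      rw [min_eq_left (h0 z), hLf]

/-- Homotopy lifting over a compact metric space.  The time at which a partial lift stops is raised
from one constant to the next by adding small multiples of the functions of a finite partition of
unity, so that each step takes place over a single neighbourhood with a transport rule. -/
theorem HasLocalTransport.liftsUpTo_one [PseudoMetricSpace Z] [CompactSpace Z]
    (hp : HasLocalTransport p) (f : Z → E) (hf : Continuous f) (H : C(Z × ℝ, B))
    (hH : ∀ z t, t ≤ 0 → p (f z) = H (z, t)) : LiftsUpTo p f H fun _ => 1 := by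
  classical
  choose V hV Γ hΓ hΓp hΓe using hp
  obtain ⟨δ, hδ, hLeb⟩ := lebesgue_number_lemma_of_metric
    (s := (Set.univ : Set Z) ×ˢ Set.Icc (0 : ℝ) 1) (c := fun b => H ⁻¹' interior (V b))
    (isCompact_univ.prod isCompact_Icc) (fun b => isOpen_interior.preimage H.continuous)
    (fun y _ => Set.mem_iUnion.2 ⟨H y, mem_interior_iff_mem_nhds.2 (hV _)⟩)
  obtain ⟨c, -, hcfin, hcov⟩ := isCompact_univ.finite_cover_balls (X := Z) hδ
  have : Finite c := hcfin
  have := Fintype.ofFinite c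
  obtain ⟨ρ, hρ⟩ := PartitionOfUnity.exists_isSubordinate_of_locallyFinite
    (isClosed_univ (X := Z)) (fun i : c => Metric.ball (i : Z) δ) (fun _ => Metric.isOpen_ball)
    (locallyFinite_of_finite _) (by rwa [Set.biUnion_eq_iUnion] at hcov)
  have hsum : ∀ z, ∑ i, ρ i z = 1 := fun z => by
    rw [← finsum_eq_sum_of_fintype]
    exact ρ.sum_eq_one (Set.mem_univ z)
  obtain ⟨N, hN0, hN⟩ := Real.exists_nat_pos_inv_lt hδ
  have hNpos : (0 : ℝ) < (N : ℝ)⁻¹ := by positivity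
  -- in the `k`-th round, multiples by `1 / N` of partial sums of the partition of unity are added
  -- to `k / N`, so that the stopping times stay between `k / N` and `(k + 1) / N`
  have key : ∀ k ≤ N, LiftsUpTo p f H fun _ => k * (N : ℝ)⁻¹ := by
    intro k
    induction k with
    | zero =>
      intro _
      refine ⟨⟨fun y => f y.1, hf.comp continuous_fst⟩, fun z t => ?_, fun z => rfl⟩
      exact hH z _ (by simp)
    | succ k ih =>
      intro hk
      have hstep : ∀ s : Finset c,
          LiftsUpTo p f H fun z => k * (N : ℝ)⁻¹ + (N : ℝ)⁻¹ * ∑ i ∈ s, ρ i z := by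
        intro s
        induction s using Finset.induction_on with
        | empty => simpa using ih (Nat.le_of_succ_le hk)
        | insert j s hj ihs =>
          have hmem : ((j : Z), (k : ℝ) * (N : ℝ)⁻¹) ∈ (Set.univ : Set Z) ×ˢ Set.Icc (0 : ℝ) 1 := by
            refine ⟨trivial, by positivity, ?_⟩
            rw [← div_eq_mul_inv, div_le_one (by positivity)]
            exact_mod_cast Nat.le_of_succ_le hk
          obtain ⟨b, hb⟩ := hLeb _ hmem
          refine ihs.extend (C := tsupport (ρ j)) (V := V b) (Γ := Γ b) (by fun_prop) (by fun_prop)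
            ?_ ?_ (isClosed_tsupport _) ?_ (hΓ b) (hΓp b) (hΓe b) ?_
          · intro z
            have := Finset.sum_nonneg fun i (_ : i ∈ s) => ρ.nonneg i z
            positivity
          · intro z
            rw [Finset.sum_insert hj]
            have := ρ.nonneg j z
            gcongr
            linarith
          · intro z hz
            rw [Finset.sum_insert hj, image_eq_zero_of_notMem_tsupport hz, zero_add]
          · intro z hz t h1 h2
            refine interior_subset (hb ?_)
            have hz' : dist z (j : Z) < δ := hρ j hz
            have hs0 := Finset.sum_nonneg fun i (_ : i ∈ s) => ρ.nonneg i z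
            have hs1 : ∑ i ∈ insert j s, ρ i z ≤ 1 := by
              rw [← hsum z]
              exact Finset.sum_le_sum_of_subset_of_nonneg (Finset.subset_univ _)
                fun i _ _ => ρ.nonneg i z
            have h3 : (N : ℝ)⁻¹ * ∑ i ∈ insert j s, ρ i z ≤ (N : ℝ)⁻¹ * 1 := by gcongr
            have h4 : 0 ≤ (N : ℝ)⁻¹ * ∑ i ∈ s, ρ i z := by positivity
            rw [Metric.mem_ball, Prod.dist_eq, max_lt_iff, Real.dist_eq, abs_lt]
            exact ⟨hz', by linarith, by linarith⟩
      convert hstep Finset.univ using 2 with z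
      rw [hsum]
      push_cast
      ring
  convert key N le_rfl using 2
  rw [mul_inv_cancel₀]
  positivity

end HomotopyLifting

/-! ### Homotopy lifting for CW complexes -/

section RelativeLifting

open Metric

variable {E B W : Type*} [TopologicalSpace E] [TopologicalSpace B] [NormedAddCommGroup W]

/-- The largest factor by which the cylinder `D × I` over the unit ball `D` can be dilated from
the centre `(0, 2)` without the point `(x, t)` leaving it. -/
def cylinderScale (y : closedBall (0 : W) 1 × unitInterval) : ℝ :=
  (max ((2 - (y.2 : ℝ)) / 2) ‖(y.1 : W)‖)⁻¹

theorem half_le_max_cylinder (y : closedBall (0 : W) 1 × unitInterval) :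
    1 / 2 ≤ max ((2 - (y.2 : ℝ)) / 2) ‖(y.1 : W)‖ := by
  refine le_max_of_le_left ?_
  linarith [y.2.2.2]

theorem continuous_cylinderScale :
    Continuous (cylinderScale : closedBall (0 : W) 1 × unitInterval → ℝ) := by
  refine Continuous.inv₀ (by fun_prop) fun y => ?_
  linarith [half_le_max_cylinder y]

theorem one_le_cylinderScale (y : closedBall (0 : W) 1 × unitInterval) : 1 ≤ cylinderScale y := by
  refine (one_le_inv₀ (by linarith [half_le_max_cylinder y])).2 (max_le ?_ ?_)
  · linarith [y.2.2.1]
  · exact mem_closedBall_zero_iff.1 y.1.2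

theorem cylinderScale_le_two (y : closedBall (0 : W) 1 × unitInterval) : cylinderScale y ≤ 2 := by
  refine (inv_le_comm₀ (by linarith [half_le_max_cylinder y]) two_pos).2 ?_
  linarith [half_le_max_cylinder y]

theorem cylinderScale_mul_norm_le (y : closedBall (0 : W) 1 × unitInterval) :
    cylinderScale y * ‖(y.1 : W)‖ ≤ 1 := by
  have h := half_le_max_cylinder y
  rw [cylinderScale, inv_mul_le_iff₀ (by linarith), mul_one]
  exact le_max_right _ _

theorem cylinderScale_mul_le (y : closedBall (0 : W) 1 × unitInterval) :
    cylinderScale y * (2 - y.2) ≤ 2 := by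
  have h := half_le_max_cylinder y
  rw [cylinderScale, inv_mul_le_iff₀ (by linarith)]
  linarith [le_max_left ((2 - (y.2 : ℝ)) / 2) ‖(y.1 : W)‖]

theorem cylinderScale_mul_eq (y : closedBall (0 : W) 1 × unitInterval) :
    cylinderScale y * (2 - y.2) = 2 ∨ cylinderScale y * ‖(y.1 : W)‖ = 1 := by
  have h := half_le_max_cylinder y
  rcases max_choice ((2 - (y.2 : ℝ)) / 2) ‖(y.1 : W)‖ with h' | h'
  · left
    rw [cylinderScale, h']
    rw [h'] at h
    rw [inv_div, div_mul_cancel₀ _ (by linarith)]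
  · right
    rw [cylinderScale, h']
    rw [h'] at h
    exact inv_mul_cancel₀ (by linarith)

theorem cylinderScale_eq_one {y : closedBall (0 : W) 1 × unitInterval}
    (hy : 1 ≤ ‖(y.1 : W)‖ ∨ y.2 = 0) : cylinderScale y = 1 := by
  refine le_antisymm (inv_le_one_of_one_le₀ ?_) (one_le_cylinderScale y)
  rcases hy with hy | hy
  · exact le_max_of_le_right hy
  · exact le_max_of_le_left (by simp [hy])

/-- The factor `cylinderScale y`, decreased at unit speed in the time `τ` until it is `1`. -/
def cylinderFactor (y : (closedBall (0 : W) 1 × unitInterval) × ℝ) : ℝ :=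
  max (cylinderScale y.1 - max y.2 0) 1

theorem cylinderFactor_le (y : (closedBall (0 : W) 1 × unitInterval) × ℝ) :
    cylinderFactor y ≤ cylinderScale y.1 :=
  max_le (by linarith [le_max_right y.2 0]) (one_le_cylinderScale _)

variable [NormedSpace ℝ W]

/-- The homotopy from the radial retraction of the cylinder `D × I` onto `D × 0 ∪ ∂D × I` to the
identity, which moves along the rays from `(0, 2)` and is at rest from the time
`cylinderScale y - 1` on. -/
def cylinderHomotopy (W : Type*) [NormedAddCommGroup W] [NormedSpace ℝ W] :
    C((closedBall (0 : W) 1 × unitInterval) × ℝ, closedBall (0 : W) 1 × unitInterval) where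
  toFun y :=
    (⟨cylinderFactor y • (y.1.1 : W), by
      have h1 : 1 ≤ cylinderFactor y := le_max_right _ _
      rw [mem_closedBall_zero_iff, norm_smul, Real.norm_of_nonneg (by linarith)]
      exact (mul_le_mul_of_nonneg_right (cylinderFactor_le y) (norm_nonneg _)).trans
        (cylinderScale_mul_norm_le _)⟩,
    ⟨2 - cylinderFactor y * (2 - y.1.2), by
      have h1 : 1 ≤ cylinderFactor y := le_max_right _ _
      have h2 := y.1.2.2.2
      have h3 : cylinderFactor y * (2 - y.1.2) ≤ 2 :=
        (mul_le_mul_of_nonneg_right (cylinderFactor_le y) (by linarith)).trans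
          (cylinderScale_mul_le _)
      constructor <;> nlinarith⟩)
  continuous_toFun := by
    have : Continuous (cylinderFactor : (closedBall (0 : W) 1 × unitInterval) × ℝ → ℝ) := by
      have := continuous_cylinderScale (W := W)
      unfold cylinderFactor
      fun_prop
    fun_prop

theorem cylinderHomotopy_eq_self {y : (closedBall (0 : W) 1 × unitInterval)} {τ : ℝ}
    (h : cylinderScale y - 1 ≤ τ) : cylinderHomotopy W (y, τ) = y := by
  have : cylinderFactor (y, τ) = 1 := max_eq_right (by dsimp only; linarith [le_max_left τ 0])
  ext
  · simp [cylinderHomotopy, this]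
  · simp [cylinderHomotopy, this]

theorem cylinderHomotopy_zero_mem {y : (closedBall (0 : W) 1 × unitInterval)} {τ : ℝ}
    (h : τ ≤ 0) : 1 ≤ ‖((cylinderHomotopy W (y, τ)).1 : W)‖ ∨
      (cylinderHomotopy W (y, τ)).2 = 0 := by
  have : cylinderFactor (y, τ) = cylinderScale y := by
    simp [cylinderFactor, max_eq_right h, one_le_cylinderScale]
  rcases cylinderScale_mul_eq y with h' | h'
  · right
    ext
    simp [cylinderHomotopy, this, h']
  · left
    have h1 := one_le_cylinderScale y
    simp [cylinderHomotopy, this, norm_smul, abs_of_nonneg (zero_le_one.trans h1), h']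

/-- The relative lifting property for the unit ball and its boundary.  The initial position and the
lift over the boundary together give a lift over `D × 0 ∪ ∂D × I`; precomposed with the retraction
it starts a lift of the homotopy `cylinderHomotopy`.  At the time when a point comes to rest, that
lift is the desired one, and for points of `D × 0 ∪ ∂D × I` this is the time `0`. -/
theorem HasLocalTransport.exists_lift_ball [ProperSpace W] {p : E → B}
    (hp : HasLocalTransport p) (f : W → E) (hf : ContinuousOn f (closedBall 0 1))
    (H : W → C(unitInterval, B)) (hH : ContinuousOn H (closedBall 0 1))
    (hfH : ∀ z ∈ closedBall (0 : W) 1, p (f z) = H z 0)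
    (a : W → C(unitInterval, E)) (ha : ContinuousOn a (sphere 0 1))
    (haH : ∀ z ∈ sphere (0 : W) 1, (∀ t, p (a z t) = H z t) ∧ a z 0 = f z) :
    ∃ a' : W → C(unitInterval, E), ContinuousOn a' (closedBall 0 1) ∧
      Set.EqOn a' a (sphere 0 1) ∧
      ∀ z ∈ closedBall (0 : W) 1, (∀ t, p (a' z t) = H z t) ∧ a' z 0 = f z := by
  classical
  -- the lift over `D × 0 ∪ ∂D × I`, the only part of the cylinder where `g` is used
  let g : closedBall (0 : W) 1 × unitInterval → E := fun y =>
    if 1 ≤ ‖(y.1 : W)‖ then a y.1 y.2 else f y.1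
  have hsph : ∀ y : closedBall (0 : W) 1 × unitInterval, 1 ≤ ‖(y.1 : W)‖ →
      (y.1 : W) ∈ sphere (0 : W) 1 := fun y hy =>
    mem_sphere_zero_iff_norm.2 (le_antisymm (mem_closedBall_zero_iff.1 y.1.2) hy)
  have hg0 : ∀ y : closedBall (0 : W) 1 × unitInterval, y.2 = 0 → g y = f y.1 := by
    intro y hy
    by_cases h : 1 ≤ ‖(y.1 : W)‖
    · simp only [g, if_pos h]
      rw [hy, (haH _ (hsph y h)).2]
    · exact if_neg h
  have hg1 : ∀ y : closedBall (0 : W) 1 × unitInterval, 1 ≤ ‖(y.1 : W)‖ → g y = a y.1 y.2 :=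
    fun y hy => if_pos hy
  have hgc : ContinuousOn g ({y | 1 ≤ ‖(y.1 : W)‖} ∪ {y | y.2 = 0}) := by
    refine ContinuousOn.union_of_isClosed ?_ ?_ (isClosed_le (by fun_prop) (by fun_prop))
      (isClosed_eq (by fun_prop) (by fun_prop))
    · refine ContinuousOn.congr ?_ hg1
      refine ContinuousOn.eval ?_ continuous_snd.continuousOn
      exact ha.comp (by fun_prop) hsph
    · refine ContinuousOn.congr ?_ hg0
      exact hf.comp (by fun_prop) fun y _ => y.1.2
  let b : C(closedBall (0 : W) 1 × unitInterval, B) :=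
    ⟨fun y => H y.1 y.2, by
      have : Continuous fun z : closedBall (0 : W) 1 => H z := hH.domRestrict
      exact (this.comp continuous_fst).eval continuous_snd⟩
  have hgb : ∀ y : closedBall (0 : W) 1 × unitInterval, (1 ≤ ‖(y.1 : W)‖ ∨ y.2 = 0) →
      p (g y) = b y := by
    rintro y (hy | hy)
    · rw [hg1 y hy, (haH _ (hsph y hy)).1]; rfl
    · rw [hg0 y hy, hfH _ y.1.2]
      simp [b, hy]
  obtain ⟨L, hLp, hL0⟩ := hp.liftsUpTo_one (fun y => g (cylinderHomotopy W (y, 0)))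
    (by
      rw [← continuousOn_univ]
      exact hgc.comp (by fun_prop) fun y _ => cylinderHomotopy_zero_mem le_rfl)
    (b.comp (cylinderHomotopy W)) (by
      intro z t ht
      have : cylinderHomotopy W (z, t) = cylinderHomotopy W (z, 0) := by
        simp [cylinderHomotopy, cylinderFactor, max_eq_right ht]
      rw [hgb _ (cylinderHomotopy_zero_mem le_rfl), ContinuousMap.comp_apply, this])
  have hsc := continuous_cylinderScale (W := W)
  let M : C(closedBall (0 : W) 1 × unitInterval, E) :=
    ⟨fun y => L (y, cylinderScale y - 1), by fun_prop⟩
  have hMp : ∀ y, p (M y) = b y := by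
    intro y
    change p (L (y, cylinderScale y - 1)) = _
    rw [hLp, min_eq_left (by linarith [cylinderScale_le_two y]), ContinuousMap.comp_apply,
      cylinderHomotopy_eq_self le_rfl]
  have hMg : ∀ y : closedBall (0 : W) 1 × unitInterval, (1 ≤ ‖(y.1 : W)‖ ∨ y.2 = 0) →
      M y = g y := by
    intro y hy
    change L (y, cylinderScale y - 1) = _
    have h1 := cylinderScale_eq_one hy
    rw [h1, sub_self, hL0]
    dsimp only
    rw [cylinderHomotopy_eq_self (by rw [h1, sub_self])]
  refine ⟨fun w => if h : w ∈ closedBall (0 : W) 1 then M.curry ⟨w, h⟩ else a w, ?_, ?_, ?_⟩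
  · rw [continuousOn_iff_continuous_domRestrict]
    refine M.curry.continuous.congr fun w => ?_
    simp only [Set.domRestrict_apply, dif_pos w.2]
  · intro w hw
    have hw' := sphere_subset_closedBall hw
    have hw1 : 1 ≤ ‖w‖ := (mem_sphere_zero_iff_norm.1 hw).ge
    simp only [dif_pos hw']
    ext t
    rw [ContinuousMap.curry_apply, hMg _ (Or.inl hw1), hg1 _ hw1]
  · intro w hw
    simp only [dif_pos hw]
    refine ⟨fun t => ?_, ?_⟩
    · rw [ContinuousMap.curry_apply, hMp]; rfl
    · rw [ContinuousMap.curry_apply, hMg _ (Or.inr rfl), hg0 _ rfl]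

/-- The homotopy lifting property for CW complexes, by cell-by-cell construction of a map from `X`
to the space of paths in `E`. -/
theorem HasLocalTransport.exists_homotopy_lift {X : Type*} [TopologicalSpace X] [T2Space X]
    [CWComplex (Set.univ : Set X)] {p : E → B} (hp : HasLocalTransport p)
    (f : C(X, E)) (H : C(unitInterval × X, B)) (hfH : ∀ x, p (f x) = H (0, x)) :
    ∃ L : C(unitInterval × X, E), (∀ y, p (L y) = H y) ∧ ∀ x, L (0, x) = f x := by
  rcases isEmpty_or_nonempty X with hX | ⟨⟨x₀⟩⟩
  · have : IsEmpty (unitInterval × X) := inferInstance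
    exact ⟨⟨isEmptyElim, continuous_of_const fun x => isEmptyElim x⟩, isEmptyElim, isEmptyElim⟩
  have : Nonempty C(unitInterval, E) := ⟨ContinuousMap.const _ (f x₀)⟩
  let H' : C(X, C(unitInterval, B)) := (H.comp ContinuousMap.prodSwap).curry
  obtain ⟨L, hLc, hL⟩ := exists_continuous_of_cellwise_extension (X := X)
    (fun x => {l : C(unitInterval, E) | (∀ t, p (l t) = H (t, x)) ∧ l 0 = f x}) (by
      intro n i a ha haR
      have hi := RelCWComplex.continuousOn n i
      exact hp.exists_lift_ball (f ∘ RelCWComplex.map n i)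
        (f.continuous.comp_continuousOn hi) (H' ∘ RelCWComplex.map n i)
        (H'.continuous.comp_continuousOn hi) (fun z _ => hfH _) a ha haR)
  exact ⟨(ContinuousMap.uncurry ⟨L, hLc⟩).comp ContinuousMap.prodSwap,
    fun y => (hL y.2).1 y.1, fun x => (hL x).2⟩

end RelativeLifting

/-! ### Coordinates and segments in Milnor's space -/

section MilnorSpace

theorem MilnorE.exists_weight_ne_zero {G : Type*} (e : MilnorE G) : ∃ i, e.weight i ≠ 0 := by
  by_contra! h
  have := e.sum_weight
  simp [h] at this

theorem MilnorE.continuous_weight {G : Type*} [TopologicalSpace G] (i : ℕ) :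
    Continuous fun e : MilnorE G => e.weight i :=
  continuous_iff_le_induced.2 (inf_le_left.trans (iInf_le _ i))

theorem MilnorE.isOpen_weight_ne_zero {G : Type*} [TopologicalSpace G] (i : ℕ) :
    IsOpen {e : MilnorE G | e.weight i ≠ 0} :=
  isOpen_ne_fun (continuous_weight i) continuous_const

variable {G : Type*} [Group G]

/-- The coordinate `gᵢ` of a point of `EG`, with the value `1` where `tᵢ = 0`. -/
def MilnorE.totalCoord (i : ℕ) (e : MilnorE G) : G := by
  classical exact if h : e.weight i ≠ 0 then e.coord i h else 1

theorem MilnorE.totalCoord_eq_coord {i : ℕ} {e : MilnorE G} (h : e.weight i ≠ 0) :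
    e.totalCoord i = e.coord i h :=
  dif_pos h

theorem MilnorE.totalCoord_eq_one {i : ℕ} {e : MilnorE G} (h : e.weight i = 0) :
    e.totalCoord i = 1 :=
  dif_neg (not_not.2 h)

theorem MilnorE.ext_totalCoord {e e' : MilnorE G} (hw : ∀ i, e.weight i = e'.weight i)
    (hc : ∀ i, e.weight i ≠ 0 → e.totalCoord i = e'.totalCoord i) : e = e' := by
  obtain ⟨w, h1, h2, h3, c⟩ := e
  obtain ⟨w', h1', h2', h3', c'⟩ := e'
  obtain rfl : w = w' := funext hw
  congr 1
  funext i h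
  have := hc i h
  rwa [totalCoord_eq_coord h, totalCoord_eq_coord (e := ⟨w, h1', h2', h3', c'⟩) h] at this

theorem MilnorE.totalCoord_op_smul {i : ℕ} {e : MilnorE G} (h : e.weight i ≠ 0) (g : G) :
    (MulOpposite.op g • e).totalCoord i = e.totalCoord i * g := by
  rw [totalCoord_eq_coord h, totalCoord_eq_coord (e := MulOpposite.op g • e) h]
  rfl

/-- The point with barycentric coordinate `s` on the segment from `e` to the vertex `1 ∈ G` of the
`k`-th factor of the join, for `e` that does not meet this factor.  All coordinates are those of
`e`, the `k`-th one being `1` by the convention of `totalCoord`. -/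
def MilnorE.toVertex (k : ℕ) (e : MilnorE G) (s : unitInterval) : MilnorE G where
  weight i := (1 - s) * e.weight i + s * (Pi.single k 1 : ℕ → ℝ) i
  weight_nonneg i := by
    have h1 : 0 ≤ (Pi.single k 1 : ℕ → ℝ) i := by
      rw [Pi.single_apply]; split_ifs <;> norm_num
    have h2 : (0 : ℝ) ≤ 1 - s := by linarith [s.2.2]
    have h3 := s.2.1
    have h4 := e.weight_nonneg i
    positivity
  finite_support := by
    refine (e.finite_support.union (Set.finite_singleton k)).subset fun i hi => ?_
    by_contra h
    simp only [Set.mem_union, Function.mem_support, not_or, not_not, Set.mem_singleton_iff] at h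
    exact hi (by simp [h.1, Pi.single_eq_of_ne h.2])
  sum_weight := by
    have h1 : (Function.support (Pi.single k 1 : ℕ → ℝ)).Finite :=
      (Set.finite_singleton k).subset Pi.support_single_subset
    have h2 : ∑ᶠ i, (Pi.single k 1 : ℕ → ℝ) i = 1 := by
      rw [finsum_eq_single _ k fun i hi => Pi.single_eq_of_ne hi _, Pi.single_eq_same]
    rw [finsum_add_distrib (e.finite_support.subset fun i hi h => hi (by simp [h]))
      (h1.subset fun i hi h => hi (by simp [h])), ← mul_finsum' _ _ e.finite_support,
      ← mul_finsum' _ _ h1, h2, e.sum_weight]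
    ring
  coord i _ := e.totalCoord i

theorem MilnorE.totalCoord_toVertex {k i : ℕ} {e : MilnorE G} {s : unitInterval}
    (h : (e.toVertex k s).weight i ≠ 0) : (e.toVertex k s).totalCoord i = e.totalCoord i :=
  totalCoord_eq_coord h

theorem MilnorE.toVertex_zero (k : ℕ) (e : MilnorE G) : e.toVertex k 0 = e :=
  ext_totalCoord (fun i => by simp [toVertex]) fun _ h => totalCoord_toVertex h

theorem MilnorE.toVertex_one {k : ℕ} {e e' : MilnorE G} (h : e.weight k = 0)
    (h' : e'.weight k = 0) : e.toVertex k 1 = e'.toVertex k 1 := by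
  have hw : ∀ (e : MilnorE G) i, (e.toVertex k 1).weight i = (Pi.single k 1 : ℕ → ℝ) i :=
    fun e i => by simp [toVertex]
  refine ext_totalCoord (fun i => by rw [hw, hw]) fun i hi => ?_
  obtain rfl : i = k := by
    by_contra hne
    exact hi (by rw [hw, Pi.single_eq_of_ne hne])
  have hi' : (e'.toVertex i 1).weight i ≠ 0 := by rw [hw, Pi.single_eq_same]; exact one_ne_zero
  rw [totalCoord_toVertex hi, totalCoord_toVertex hi', totalCoord_eq_one h, totalCoord_eq_one h']

/-! ### Orbits and charts of `EG → BG` -/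

variable (G) in
/-- The projection `EG → BG`. -/
def bundleProj : MilnorE G → MilnorB G := Quotient.mk _

theorem bundleProj_op_smul (g : G) (e : MilnorE G) :
    bundleProj G (MulOpposite.op g • e) = bundleProj G e :=
  Quotient.sound ⟨MulOpposite.op g, rfl⟩

theorem exists_op_smul_of_bundleProj_eq {e e' : MilnorE G} (h : bundleProj G e' = bundleProj G e) :
    ∃ g : G, e' = MulOpposite.op g • e := by
  obtain ⟨g, hg⟩ := Quotient.exact h
  exact ⟨g.unop, hg.symm⟩

/-- The open set `tᵢ ≠ 0` of `BG`. -/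
def chartDomain (G : Type*) [Group G] (i : ℕ) : Set (MilnorB G) :=
  bundleProj G '' {e | e.weight i ≠ 0}

theorem bundleProj_mem_chartDomain {i : ℕ} {e : MilnorE G} :
    bundleProj G e ∈ chartDomain G i ↔ e.weight i ≠ 0 := by
  constructor
  · rintro ⟨e', he', h⟩
    obtain ⟨g, rfl⟩ := exists_op_smul_of_bundleProj_eq h
    exact he'
  · exact fun h => ⟨e, h, rfl⟩

/-- The section of `EG → BG` over `tᵢ ≠ 0` with `i`-th coordinate `gᵢ = 1`: the representative
`b.out` is translated by the inverse of its `i`-th coordinate.  The value is arbitrary where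
`tᵢ = 0`. -/
def chartSection (i : ℕ) (b : MilnorB G) : MilnorE G :=
  MulOpposite.op (b.out.totalCoord i)⁻¹ • b.out

theorem chartSection_bundleProj {i : ℕ} {e : MilnorE G} (h : e.weight i ≠ 0) :
    chartSection i (bundleProj G e) = MulOpposite.op (e.totalCoord i)⁻¹ • e := by
  obtain ⟨g, hg⟩ := exists_op_smul_of_bundleProj_eq (e := e) (e' := (bundleProj G e).out)
    (Quotient.out_eq _)
  rw [chartSection, hg, MilnorE.totalCoord_op_smul h, smul_smul, ← MulOpposite.op_mul]
  congr 2
  group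

theorem bundleProj_chartSection (i : ℕ) (b : MilnorB G) : bundleProj G (chartSection i b) = b := by
  rw [chartSection, bundleProj_op_smul]
  exact Quotient.out_eq b

/-! ### The topology of Milnor's space -/

variable [TopologicalSpace G]

theorem MilnorE.continuousOn_totalCoord (i : ℕ) :
    ContinuousOn (MilnorE.totalCoord (G := G) i) {e | e.weight i ≠ 0} := by
  refine (continuousOn_open_iff (isOpen_weight_ne_zero i)).2 fun U hU => ?_
  have h : IsOpen {e : MilnorE G | ∃ h : e.weight i ≠ 0, e.coord i h ∈ U} :=
    (inf_le_right.trans (iInf_le _ i) : instTopologicalSpaceMilnorE (G := G) ≤ _) _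
      (TopologicalSpace.isOpen_generateFrom_of_mem ⟨U, hU, rfl⟩)
  convert h using 1
  ext e
  constructor
  · rintro ⟨h1, h2⟩
    exact ⟨h1, by rwa [← totalCoord_eq_coord h1]⟩
  · rintro ⟨h1, h2⟩
    exact ⟨h1, by rwa [Set.mem_preimage, totalCoord_eq_coord h1]⟩

theorem MilnorE.continuous_of_coordinates {Y : Type*} [TopologicalSpace Y] {f : Y → MilnorE G}
    (hw : ∀ i, Continuous fun y => (f y).weight i)
    (hc : ∀ i, ContinuousOn (fun y => (f y).totalCoord i) {y | (f y).weight i ≠ 0}) :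
    Continuous f := by
  refine continuous_inf_rng.2 ⟨continuous_iInf_rng.2 fun i => ?_, continuous_iInf_rng.2 fun i => ?_⟩
  · exact continuous_induced_rng.2 (hw i)
  · refine continuous_generateFrom_iff.2 ?_
    rintro _ ⟨U, hU, rfl⟩
    convert (hc i).isOpen_inter_preimage (isOpen_ne_fun (hw i) continuous_const) hU using 1
    ext y
    constructor
    · rintro ⟨h1, h2⟩
      exact ⟨h1, by rwa [Set.mem_preimage, totalCoord_eq_coord h1]⟩
    · rintro ⟨h1, h2⟩
      exact ⟨h1, by rwa [← totalCoord_eq_coord h1]⟩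

/-- Two maps to `EG` that avoid the `k`-th factor of the join are homotopic: each of them can be
contracted along line segments to the vertex `1` of that factor. -/
theorem MilnorE.homotopic_of_weight_eq_zero {X : Type*} [TopologicalSpace X] (k : ℕ)
    (f f' : C(X, MilnorE G)) (hf : ∀ x, (f x).weight k = 0) (hf' : ∀ x, (f' x).weight k = 0) :
    f.Homotopic f' := by
  have hcont : ∀ f : C(X, MilnorE G), (∀ x, (f x).weight k = 0) →
      Continuous fun y : unitInterval × X => (f y.2).toVertex k y.1 := by
    intro f hf
    refine continuous_of_coordinates (fun i => ?_) (fun i => ?_)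
    · have hw : Continuous fun y : unitInterval × X => (f y.2).weight i :=
        (continuous_weight i).comp (f.continuous.comp continuous_snd)
      have hs : Continuous fun y : unitInterval × X => (y.1 : ℝ) := by fun_prop
      exact ((continuous_const.sub hs).mul hw).add (hs.mul continuous_const)
    · refine ContinuousOn.congr ?_ fun y hy => totalCoord_toVertex hy
      by_cases hi : i = k
      · subst hi
        simp only [totalCoord_eq_one (hf _)]
        exact continuousOn_const
      · refine (continuousOn_totalCoord i).comp (by fun_prop) fun y hy h => hy ?_
        change (f y.2).weight i = 0 at h
        simp [toVertex, h, Pi.single_eq_of_ne hi]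
  have key : ∀ f : C(X, MilnorE G), (hf : ∀ x, (f x).weight k = 0) →
      ∀ g : C(X, MilnorE G), (∀ x, g x = (f x).toVertex k 1) → f.Homotopic g := fun f hf g hg =>
    ⟨⟨⟨_, hcont f hf⟩, fun x => toVertex_zero k (f x), fun x => (hg x).symm⟩⟩
  let v : C(X, MilnorE G) := 
    ⟨fun x => (f x).toVertex k 1, (hcont f hf).comp (Continuous.prodMk_right 1)⟩
  exact (key f hf v fun _ => rfl).trans
    (key f' hf' v fun x => toVertex_one (hf x) (hf' x)).symm

theorem MilnorE.homotopic_const {X : Type*} [TopologicalSpace X] (e e' : MilnorE G) :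
    (ContinuousMap.const X e).Homotopic (ContinuousMap.const X e') := by
  obtain ⟨k, hk⟩ := (e.finite_support.union e'.finite_support).infinite_compl.nonempty
  simp only [Set.mem_compl_iff, Set.mem_union, Function.mem_support, not_or, not_not] at hk
  exact homotopic_of_weight_eq_zero k _ _ (fun _ => hk.1) (fun _ => hk.2)

theorem projB_mk (T : Subgroup G) (e : MilnorE G) : projB T (Quotient.mk _ e) = bundleProj G e :=
  rfl

variable [IsTopologicalGroup G]

theorem MilnorE.continuous_op_smul :
    Continuous fun y : MilnorE G × G => MulOpposite.op y.2 • y.1 := by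
  refine continuous_of_coordinates (fun i => ?_) (fun i => ?_)
  · change Continuous fun y : MilnorE G × G => y.1.weight i
    exact (continuous_weight i).comp continuous_fst
  refine ContinuousOn.congr (f := fun y => y.1.totalCoord i * y.2) ?_
    fun y hy => totalCoord_op_smul (by exact hy) _
  exact ((continuousOn_totalCoord i).comp continuousOn_fst fun y hy => hy).mul continuousOn_snd

instance : ContinuousConstSMul Gᵐᵒᵖ (MilnorE G) :=
  ⟨fun g => MilnorE.continuous_op_smul.comp (g := fun y : MilnorE G × G => MulOpposite.op y.2 • y.1)
    (Continuous.prodMk_left g.unop)⟩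

instance (T : Subgroup G) : ContinuousConstSMul T.op (MilnorE G) :=
  ⟨fun g => continuous_const_smul (g : Gᵐᵒᵖ)⟩

/-- Every map `x ↦ e · v x` into the orbit of `e` is null-homotopic in `EG`, by way of a factor of
the join that `e` does not meet. -/
theorem MilnorE.homotopic_orbit {X : Type*} [TopologicalSpace X] (e : MilnorE G) (v : C(X, G)) :
    ((⟨_, continuous_orbit e⟩ : C(G, MilnorE G)).comp v).Homotopic (ContinuousMap.const X e) := by
  obtain ⟨k, hk⟩ := e.finite_support.infinite_compl.nonempty
  simp only [Set.mem_compl_iff, Function.mem_support, not_not] at hk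
  exact homotopic_of_weight_eq_zero k _ _ (fun _ => hk) (fun _ => hk)

/-! ### Local transport in the bundles over `BG` -/

theorem isOpenQuotientMap_bundleProj : IsOpenQuotientMap (bundleProj G) :=
  MulAction.isOpenQuotientMap_quotientMk

theorem isOpen_chartDomain (i : ℕ) : IsOpen (chartDomain G i) :=
  isOpenQuotientMap_bundleProj.isOpenMap _ (MilnorE.isOpen_weight_ne_zero i)

theorem exists_mem_chartDomain (b : MilnorB G) : ∃ i, b ∈ chartDomain G i := by
  obtain ⟨e, rfl⟩ := isOpenQuotientMap_bundleProj.surjective b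
  obtain ⟨i, hi⟩ := e.exists_weight_ne_zero
  exact ⟨i, bundleProj_mem_chartDomain.2 hi⟩

theorem continuousOn_of_comp_isOpenQuotientMap {Y Z W : Type*} [TopologicalSpace Y]
    [TopologicalSpace Z] [TopologicalSpace W] {q : Y → Z} (hq : IsOpenQuotientMap q) {f : Z → W}
    {s : Set Z} (hs : IsOpen s) (hf : ContinuousOn (f ∘ q) (q ⁻¹' s)) : ContinuousOn f s := by
  intro z hz
  obtain ⟨y, rfl⟩ := hq.surjective z
  exact (hq.continuousAt_comp_iff.1
    (hf.continuousAt ((hs.preimage hq.continuous).mem_nhds hz))).continuousWithinAt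

theorem continuousOn_chartSection (i : ℕ) : ContinuousOn (chartSection i) (chartDomain G i) := by
  refine continuousOn_of_comp_isOpenQuotientMap isOpenQuotientMap_bundleProj
    (isOpen_chartDomain i) ?_
  have h1 : ContinuousOn (fun e : MilnorE G => MulOpposite.op (e.totalCoord i)⁻¹ • e)
      {e | e.weight i ≠ 0} :=
    MilnorE.continuous_op_smul.comp_continuousOn
      (continuousOn_id.prodMk (MilnorE.continuousOn_totalCoord i).inv)
  refine (h1.congr fun e he => chartSection_bundleProj he).mono fun e he => ?_
  exact bundleProj_mem_chartDomain.1 he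

theorem hasLocalTransport_bundleProj : HasLocalTransport (bundleProj G) := by
  intro b
  obtain ⟨i, hi⟩ := exists_mem_chartDomain b
  refine ⟨chartDomain G i, (isOpen_chartDomain i).mem_nhds hi,
    fun y => MulOpposite.op (y.2.totalCoord i) • chartSection i y.1, ?_, ?_, ?_⟩
  · refine MilnorE.continuous_op_smul.comp_continuousOn (ContinuousOn.prodMk ?_ ?_)
    · exact (continuousOn_chartSection i).comp continuousOn_fst fun y hy => hy.1
    · exact (MilnorE.continuousOn_totalCoord i).comp continuousOn_snd
        fun y hy => bundleProj_mem_chartDomain.1 hy.2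
  · intro y _ e _
    rw [bundleProj_op_smul, bundleProj_chartSection]
  · intro e he
    dsimp only
    rw [chartSection_bundleProj (bundleProj_mem_chartDomain.1 he), smul_smul,
      ← MulOpposite.op_mul, inv_mul_cancel, MulOpposite.op_one, one_smul]

variable (T : Subgroup G)

theorem isOpenQuotientMap_subgroupB :
    IsOpenQuotientMap (Quotient.mk _ : MilnorE G → SubgroupB T) :=
  MulAction.isOpenQuotientMap_quotientMk

theorem fibreIncl_mk (e : MilnorE G) (g : G) :
    fibreIncl T e (g : G ⧸ T) = Quotient.mk _ (MulOpposite.op g • e) :=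
  rfl

theorem fibreIncl_op_smul (e : MilnorE G) (v : G) (c : G ⧸ T) :
    fibreIncl T (MulOpposite.op v • e) c = fibreIncl T e (v • c) := by
  induction c using QuotientGroup.induction_on with
  | H g =>
    change fibreIncl T _ (g : G ⧸ T) = fibreIncl T e ((v * g : G) : G ⧸ T)
    rw [fibreIncl_mk, fibreIncl_mk, smul_smul, MulOpposite.op_mul]

theorem projB_fibreIncl (e : MilnorE G) (c : G ⧸ T) :
    projB T (fibreIncl T e c) = bundleProj G e := by
  induction c using QuotientGroup.induction_on with
  | H g => rw [fibreIncl_mk, projB_mk, bundleProj_op_smul]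

theorem exists_fibreIncl_eq {e : MilnorE G} {z : SubgroupB T} (h : projB T z = bundleProj G e) :
    ∃ c, fibreIncl T e c = z := by
  obtain ⟨e', rfl⟩ := (isOpenQuotientMap_subgroupB T).surjective z
  obtain ⟨g, rfl⟩ := exists_op_smul_of_bundleProj_eq h
  exact ⟨g, rfl⟩

theorem continuous_fibreIncl :
    Continuous fun y : MilnorE G × (G ⧸ T) => fibreIncl T y.1 y.2 := by
  have hq : IsOpenQuotientMap (Prod.map (id : MilnorE G → MilnorE G)
      (QuotientGroup.mk : G → G ⧸ T)) :=
    IsOpenQuotientMap.id.prodMap QuotientGroup.isOpenQuotientMap_mk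
  rw [← hq.continuous_comp_iff]
  exact (isOpenQuotientMap_subgroupB T).continuous.comp MilnorE.continuous_op_smul

/-- The coset `gᵢ T` of the `i`-th coordinate of a point of `BT`; it is the identity coset where
`tᵢ = 0`. -/
def cosetCoord (i : ℕ) : SubgroupB T → G ⧸ T :=
  Quotient.lift (fun e => ((e.totalCoord i : G) : G ⧸ T)) (by
    rintro _ e ⟨⟨t, ht⟩, rfl⟩
    by_cases h : e.weight i = 0
    · rw [MilnorE.totalCoord_eq_one h, MilnorE.totalCoord_eq_one]
      exact h
    · refine QuotientGroup.eq.2 ?_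
      have := MilnorE.totalCoord_op_smul h t.unop
      change ((t • e).totalCoord i)⁻¹ * _ ∈ T
      rw [MulOpposite.op_unop] at this
      rw [this]
      simpa using ht)

theorem continuousOn_cosetCoord (i : ℕ) :
    ContinuousOn (cosetCoord T i) (projB T ⁻¹' chartDomain G i) := by
  refine continuousOn_of_comp_isOpenQuotientMap (isOpenQuotientMap_subgroupB T)
    ((isOpen_chartDomain i).preimage (projB T).continuous) ?_
  exact QuotientGroup.continuous_mk.comp_continuousOn
    ((MilnorE.continuousOn_totalCoord i).mono fun e he => bundleProj_mem_chartDomain.1 he)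

theorem cosetCoord_fibreIncl {i : ℕ} {e : MilnorE G} (h : e.weight i ≠ 0) (c : G ⧸ T) :
    cosetCoord T i (fibreIncl T e c) = e.totalCoord i • c := by
  induction c using QuotientGroup.induction_on with
  | H g =>
    exact congrArg (QuotientGroup.mk : G → G ⧸ T) (MilnorE.totalCoord_op_smul h g)

theorem fibreIncl_injective (e : MilnorE G) : Function.Injective (fibreIncl T e) := by
  intro c c' h
  obtain ⟨i, hi⟩ := e.exists_weight_ne_zero
  have := congrArg (cosetCoord T i) h
  rw [cosetCoord_fibreIncl T hi, cosetCoord_fibreIncl T hi] at this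
  exact smul_left_cancel _ this

/-- A point `[e]` over a chart is moved to the point `[s · gᵢ]` of another fibre, where `s` is the
value of the section of that chart and `gᵢ` the `i`-th coordinate of `e`. -/
theorem hasLocalTransport_projB : HasLocalTransport (projB T) := by
  intro b
  obtain ⟨i, hi⟩ := exists_mem_chartDomain b
  refine ⟨chartDomain G i, (isOpen_chartDomain i).mem_nhds hi,
    fun y => fibreIncl T (chartSection i y.1) (cosetCoord T i y.2), ?_, ?_, ?_⟩
  · refine (continuous_fibreIncl T).comp_continuousOn (ContinuousOn.prodMk ?_ ?_)
    · exact (continuousOn_chartSection i).comp continuousOn_fst fun y hy => hy.1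
    · exact (continuousOn_cosetCoord T i).comp continuousOn_snd fun y hy => hy.2
  · intro y _ z _
    rw [projB_fibreIncl, bundleProj_chartSection]
  · intro z hz
    obtain ⟨e, rfl⟩ := (isOpenQuotientMap_subgroupB T).surjective z
    have he : e.weight i ≠ 0 := bundleProj_mem_chartDomain.1 hz
    dsimp only
    rw [projB_mk, chartSection_bundleProj he, fibreIncl_op_smul]
    change fibreIncl T e (((e.totalCoord i)⁻¹ * e.totalCoord i : G) : G ⧸ T) = _
    rw [inv_mul_cancel, fibreIncl_mk, MulOpposite.op_one, one_smul]

/-- A family of points `[y x · c x]` of `BT` determines the family of cosets `c` continuously. -/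
theorem continuous_of_fibreIncl {X : Type*} [TopologicalSpace X] {y : X → MilnorE G}
    (hy : Continuous y) {c : X → G ⧸ T} (hc : Continuous fun x => fibreIncl T (y x) (c x)) :
    Continuous c := by
  refine continuous_iff_continuousAt.2 fun x => ?_
  obtain ⟨i, hi⟩ := (y x).exists_weight_ne_zero
  have hs := ((MilnorE.isOpen_weight_ne_zero i).preimage hy)
  refine ContinuousOn.continuousAt (s := y ⁻¹' {e | e.weight i ≠ 0}) ?_ (hs.mem_nhds hi)
  have h1 := (MilnorE.continuousOn_totalCoord i).comp hy.continuousOn (fun x hx => hx)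
  have h2 := (continuousOn_cosetCoord T i).comp (s := y ⁻¹' {e | e.weight i ≠ 0})
    hc.continuousOn (fun x hx => by
      rw [Set.mem_preimage, projB_fibreIncl]
      exact bundleProj_mem_chartDomain.2 hx)
  refine (h1.inv.smul h2).congr fun x hx => ?_
  change c x = (MilnorE.totalCoord i (y x))⁻¹ • cosetCoord T i (fibreIncl T (y x) (c x))
  rw [cosetCoord_fibreIncl T hx, inv_smul_smul]

/-- A family of points `e · v x` of an orbit in `EG` determines the family `v` continuously. -/
theorem continuous_of_orbit {X : Type*} [TopologicalSpace X] (e : MilnorE G) {v : X → G}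
    (hv : Continuous fun x => MulOpposite.op (v x) • e) : Continuous v := by
  obtain ⟨i, hi⟩ := e.exists_weight_ne_zero
  have h := (MilnorE.continuousOn_totalCoord i).comp_continuous hv fun _ => hi
  have h' := (continuous_const (y := (e.totalCoord i)⁻¹)).mul h
  refine h'.congr fun x => ?_
  simp only [Pi.mul_apply, Function.comp]
  rw [MilnorE.totalCoord_op_smul hi, inv_mul_cancel_left]

end MilnorSpace

/-! ### Translations of `G/T` and local cross-sections -/

section CrossSections

theorem kappaFun_smul {G : Type*} [Group G] {T : Subgroup G} [IsMulCommutative T] (y : G ⧸ T)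
    (t : T) :
    kappaFun T (y, t) • y = y := by
  induction y using QuotientGroup.induction_on with
  | H g =>
    rw [kappaFun_mk, MulAction.Quotient.smul_mk, smul_eq_mul, inv_mul_cancel_right]
    exact QuotientGroup.mk_mul_of_mem _ t.2

variable {G : Type*} [Group G] [TopologicalSpace G] [IsTopologicalGroup G] {T : Subgroup G}

theorem HasLocalCrossSections.exists_at (h : HasLocalCrossSections T) (c : G ⧸ T) :
    ∃ U ∈ 𝓝 c, ∃ s : G ⧸ T → G, ContinuousOn s U ∧ ∀ x ∈ U, (s x : G ⧸ T) = x := by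
  obtain ⟨U, hU, s, hs, hsU⟩ := h
  induction c using QuotientGroup.induction_on with
  | H g =>
    have hc : Continuous fun x : G ⧸ T => g⁻¹ • x := continuous_const_smul _
    refine ⟨(fun x => g⁻¹ • x) ⁻¹' U, hc.continuousAt.preimage_mem_nhds ?_,
      fun x => g * s (g⁻¹ • x), continuousOn_const.mul (hs.comp hc.continuousOn fun x hx => hx), ?_⟩
    · change U ∈ 𝓝 ((g⁻¹ * g : G) : G ⧸ T)
      rwa [inv_mul_cancel]
    · intro x hx
      change g • ((s (g⁻¹ • x) : G) : G ⧸ T) = x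
      rw [hsU _ hx, smul_inv_smul]

/-- If `G → G/T` is locally trivial, then so is the bundle of the elements `g` that translate a
point `y` of `G/T` to a point `z`; its fibre over `(y, z) = (aT, bT)` is `b T a⁻¹`. -/
theorem HasLocalCrossSections.hasLocalTransport (h : HasLocalCrossSections T) :
    HasLocalTransport fun q : G × (G ⧸ T) => (q.2, q.1 • q.2) := by
  rintro ⟨y₀, z₀⟩
  obtain ⟨U, hU, s, hs, hsU⟩ := h.exists_at y₀
  obtain ⟨U', hU', s', hs', hsU'⟩ := h.exists_at z₀
  refine ⟨U ×ˢ U', prod_mem_nhds hU hU', fun q =>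
    (s' q.1.2 * ((s' (q.2.1 • q.2.2))⁻¹ * q.2.1 * s q.2.2) * (s q.1.1)⁻¹, q.1.1), ?_, ?_, ?_⟩
  · refine ContinuousOn.prodMk ?_ (by fun_prop)
    have h1 : ContinuousOn (fun q : ((G ⧸ T) × (G ⧸ T)) × G × (G ⧸ T) => s' q.1.2)
        ((U ×ˢ U') ×ˢ ((fun q : G × (G ⧸ T) => (q.2, q.1 • q.2)) ⁻¹' (U ×ˢ U'))) :=
      hs'.comp (by fun_prop) fun q hq => hq.1.2
    have h2 : ContinuousOn (fun q : ((G ⧸ T) × (G ⧸ T)) × G × (G ⧸ T) => s' (q.2.1 • q.2.2))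
        ((U ×ˢ U') ×ˢ ((fun q : G × (G ⧸ T) => (q.2, q.1 • q.2)) ⁻¹' (U ×ˢ U'))) :=
      hs'.comp (by fun_prop) fun q hq => hq.2.2
    have h3 : ContinuousOn (fun q : ((G ⧸ T) × (G ⧸ T)) × G × (G ⧸ T) => s q.2.2)
        ((U ×ˢ U') ×ˢ ((fun q : G × (G ⧸ T) => (q.2, q.1 • q.2)) ⁻¹' (U ×ˢ U'))) :=
      hs.comp (by fun_prop) fun q hq => hq.2.1
    have h4 : ContinuousOn (fun q : ((G ⧸ T) × (G ⧸ T)) × G × (G ⧸ T) => s q.1.1)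
        ((U ×ˢ U') ×ˢ ((fun q : G × (G ⧸ T) => (q.2, q.1 • q.2)) ⁻¹' (U ×ˢ U'))) :=
      hs.comp (by fun_prop) fun q hq => hq.1.1
    exact (h1.mul ((h2.inv.mul (by fun_prop)).mul h3)).mul h4.inv
  · rintro ⟨y, z⟩ ⟨hy, hz⟩ ⟨g, y'⟩ ⟨hy', hz'⟩
    -- the middle factor lies in `T`, because it maps the identity coset to itself
    have ht : (s' (g • y'))⁻¹ * g * s y' ∈ T := by
      rw [mul_assoc]
      refine QuotientGroup.eq.1 ?_
      rw [hsU' _ hz', ← smul_eq_mul, ← MulAction.Quotient.smul_mk, hsU _ hy']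
    refine Prod.ext rfl ?_
    dsimp only
    conv_lhs => enter [2]; rw [← hsU y hy]
    rw [MulAction.Quotient.smul_mk, smul_eq_mul, inv_mul_cancel_right,
      QuotientGroup.mk_mul_of_mem _ ht, hsU' z hz]
  · rintro ⟨g, y⟩ _
    refine Prod.ext ?_ rfl
    dsimp only
    group

/-- A continuous family of elements `w x` of the stabilizers of the points `u x` comes from a
continuous family of elements of `T`. -/
theorem HasLocalCrossSections.exists_kappa_eq [IsMulCommutative T] (h : HasLocalCrossSections T)
    {X : Type*} [TopologicalSpace X] (u : C(X, G ⧸ T)) (w : C(X, G))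
    (hw : ∀ x, w x • u x = u x) : ∃ t : C(X, T), (kappa T).comp (u.prodMk t) = w := by
  have hex : ∀ x, ∃ t : T, kappaFun T (u x, t) = w x := by
    intro x
    have := hw x
    obtain ⟨g, hg⟩ := QuotientGroup.mk_surjective (u x)
    rw [← hg] at this ⊢
    refine ⟨⟨g⁻¹ * w x * g, ?_⟩, ?_⟩
    · rw [mul_assoc]
      exact QuotientGroup.eq.1 this.symm
    · rw [kappaFun_mk]
      group
  choose t ht using hex
  refine ⟨⟨t, continuous_iff_continuousAt.2 fun x => ?_⟩, ContinuousMap.ext ht⟩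
  obtain ⟨U, hU, s, hs, hsU⟩ := h.exists_at (u x)
  have hUx := u.continuous.continuousAt.preimage_mem_nhds hU
  refine ContinuousOn.continuousAt (s := u ⁻¹' U) ?_ hUx
  rw [Topology.IsInducing.subtypeVal.continuousOn_iff]
  have h1 : ContinuousOn (fun x => s (u x)) (u ⁻¹' U) :=
    hs.comp u.continuous.continuousOn fun x hx => hx
  refine ((h1.inv.mul w.continuous.continuousOn).mul h1).congr fun x' hx' => ?_
  have h2 := ht x'
  rw [← hsU _ hx', kappaFun_mk] at h2
  change ((t x' : T) : G) = (s (u x'))⁻¹ * w x' * s (u x')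
  rw [← h2]
  group

end CrossSections

/-! ### The exact sequence -/

section Exactness

variable {G : Type*} [Group G] [TopologicalSpace G] [IsTopologicalGroup G] (T : Subgroup G)
  {X : Type*} [TopologicalSpace X] (e : MilnorE G)

/-- A map into the fibre of `π` over `[e]` factors through the inclusion of `G/T`. -/
theorem exists_fibreIncl_comp_eq (f : C(X, SubgroupB T))
    (hf : ∀ x, projB T (f x) = bundleProj G e) :
    ∃ u : C(X, G ⧸ T), (fibreIncl T e).comp u = f := by
  choose c hc using fun x => exists_fibreIncl_eq T (hf x)
  refine ⟨⟨c, continuous_of_fibreIncl T (y := fun _ => e) continuous_const ?_⟩,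
    ContinuousMap.ext hc⟩
  simpa only [hc] using f.continuous

theorem exists_lift_iff_nullhomotopic [T2Space X] [CWComplex (Set.univ : Set X)]
    (f : C(X, SubgroupB T)) :
    (∃ u : C(X, G ⧸ T), ((fibreIncl T e).comp u).Homotopic f) ↔
      ((projB T).comp f).Nullhomotopic := by
  constructor
  · rintro ⟨u, hu⟩
    refine ⟨bundleProj G e, ?_⟩
    have h := ((ContinuousMap.Homotopic.refl (projB T)).comp hu).symm
    convert h using 1
    ext x
    exact (projB_fibreIncl T e (u x)).symm
  · rintro ⟨b, hb⟩
    obtain ⟨e', rfl⟩ := isOpenQuotientMap_bundleProj.surjective b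
    -- the constant maps to `[e']` and `[e]` are homotopic because `EG` is path connected
    have hc : (ContinuousMap.const X (bundleProj G e')).Homotopic
        (ContinuousMap.const X (bundleProj G e)) :=
      (ContinuousMap.Homotopic.refl
        (⟨bundleProj G, isOpenQuotientMap_bundleProj.continuous⟩ : C(_, _))).comp
        (MilnorE.homotopic_const e' e)
    obtain ⟨F⟩ := hb.trans hc
    obtain ⟨L, hL, hL0⟩ := (hasLocalTransport_projB T).exists_homotopy_lift f F.toContinuousMap
      fun x => (F.apply_zero x).symm
    let f' : C(X, SubgroupB T) := ⟨fun x => L (1, x), by fun_prop⟩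
    obtain ⟨u, hu⟩ := exists_fibreIncl_comp_eq T e f' fun x => by
      change projB T (L (1, x)) = _
      rw [hL]
      exact F.apply_one x
    refine ⟨u, ?_⟩
    rw [hu]
    have hff' : f.Homotopic f' := ⟨⟨L, hL0, fun x => rfl⟩⟩
    exact hff'.symm

/-- The translate of `u` by a map `v : X → G` becomes homotopic to `u` in `BT`. -/
theorem homotopic_fibreIncl_comp_mapSmul (v : C(X, G)) (u : C(X, G ⧸ T)) :
    ((fibreIncl T e).comp (mapSmul v u)).Homotopic ((fibreIncl T e).comp u) := by
  let m : C(MilnorE G × (G ⧸ T), SubgroupB T) := ⟨_, continuous_fibreIncl T⟩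
  have h := (ContinuousMap.Homotopic.refl m).comp
    ((MilnorE.homotopic_orbit e v).prodMk (ContinuousMap.Homotopic.refl u))
  convert h using 1
  · ext x
    exact (fibreIncl_op_smul T e (v x) (u x)).symm
  · rfl

/-- Maps to `G/T` that become homotopic in `BT` differ, up to homotopy, by a map to `G`. -/
theorem exists_mapSmul_homotopic [T2Space X] [CWComplex (Set.univ : Set X)] (u u' : C(X, G ⧸ T))
    (h : ((fibreIncl T e).comp u').Homotopic ((fibreIncl T e).comp u)) :
    ∃ v : C(X, G), (mapSmul v u').Homotopic u := by
  obtain ⟨F⟩ := h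
  -- lift the image of the homotopy in `BG`, which is a loop of maps at the constant map `[e]`
  obtain ⟨L, hL, hL0⟩ := (hasLocalTransport_bundleProj (G := G)).exists_homotopy_lift
    (ContinuousMap.const X e) ((projB T).comp F.toContinuousMap) fun x => by
      change bundleProj G e = projB T (F (0, x))
      rw [F.apply_zero]
      exact (projB_fibreIncl T e (u' x)).symm
  have hL1 : ∀ x, bundleProj G (L (1, x)) = bundleProj G e := fun x => by
    rw [hL]
    change projB T (F (1, x)) = _
    rw [F.apply_one]
    exact projB_fibreIncl T e (u x)
  choose v hv using fun x => exists_op_smul_of_bundleProj_eq (hL1 x)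
  have hvc : Continuous v := continuous_of_orbit e (by
    simp only [← hv]
    fun_prop)
  -- compare the homotopy in `BT` with the lift to `EG`
  choose c hc using fun y => exists_fibreIncl_eq T (hL y).symm
  have hcc : Continuous c := continuous_of_fibreIncl T L.continuous (by
    simp only [hc]
    exact ((F.toContinuousMap).continuous))
  have hc0 : ∀ x, c (0, x) = u' x := fun x => by
    refine fibreIncl_injective T e ?_
    have := hc (0, x)
    rw [hL0] at this
    exact this.trans (F.apply_zero x)
  have hc1 : ∀ x, v x • c (1, x) = u x := fun x => by
    refine fibreIncl_injective T e ?_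
    have := hc (1, x)
    rw [hv, fibreIncl_op_smul] at this
    exact this.trans (F.apply_one x)
  refine ⟨⟨v, hvc⟩, ⟨⟨⟨fun y => v y.2 • c y, by fun_prop⟩, fun x => ?_, fun x => hc1 x⟩⟩⟩
  change v x • c (0, x) = v x • u' x
  rw [hc0]

theorem postcomp_mk {Y Z : Type*} [TopologicalSpace Y] [TopologicalSpace Z] (j : C(Y, Z))
    (f : C(X, Y)) : HClass.postcomp j (HClass.mk f) = HClass.mk (j.comp f) :=
  rfl

theorem orbit_eq_fibre [T2Space X] [CWComplex (Set.univ : Set X)] (y : HClass X (G ⧸ T)) :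
    MulAction.orbit (HClass X G) y =
      {y' | HClass.postcomp (fibreIncl T e) y' = HClass.postcomp (fibreIncl T e) y} := by
  induction y using HClass.ind with
  | h u =>
    ext y'
    induction y' using HClass.ind with
    | h u' =>
      rw [Set.mem_ofPred_eq, postcomp_mk, postcomp_mk, HClass.mk_eq_mk]
      constructor
      · rintro ⟨a, ha⟩
        induction a using HClass.ind with
        | h v =>
          have ha' : (mapSmul v u).Homotopic u' := HClass.mk_eq_mk.1 ha
          exact ((ContinuousMap.Homotopic.refl _).comp ha').symm.trans
            (homotopic_fibreIncl_comp_mapSmul T e v u)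
      · intro h
        obtain ⟨v, hv⟩ := exists_mapSmul_homotopic T e u' u h.symm
        exact ⟨HClass.mk v, HClass.mk_eq_mk.2 hv⟩

theorem range_kappaHom_le_stabilizer [IsMulCommutative T] (u : C(X, G ⧸ T)) :
    (kappaHom T u).range ≤ MulAction.stabilizer (HClass X G) (HClass.mk u) := by
  rintro _ ⟨a, rfl⟩
  induction a using HClass.ind with
  | h v => exact congrArg HClass.mk (ContinuousMap.ext fun x => kappaFun_smul (u x) (v x))

/-- The homotopy from `u` to `v • u` is lifted to a homotopy of maps `X → G` that starts at `1` and
carries `u` along; its end `v'` satisfies `v' • u = v • u`, so that `v'⁻¹ * v`, which is homotopic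
to `v`, takes values in the stabilizers of the points of `u`. -/
theorem stabilizer_le_range_kappaHom [IsMulCommutative T] [T2Space X]
    [CWComplex (Set.univ : Set X)] (hT : HasLocalCrossSections T) (u : C(X, G ⧸ T)) :
    MulAction.stabilizer (HClass X G) (HClass.mk u) ≤ (kappaHom T u).range := by
  intro a ha
  induction a using HClass.ind with
  | h v =>
    obtain ⟨F⟩ : u.Homotopic (mapSmul v u) :=
      (HClass.mk_eq_mk.1 (MulAction.mem_stabilizer_iff.1 ha)).symm
    obtain ⟨L, hL, hL0⟩ := hT.hasLocalTransport.exists_homotopy_lift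
      ((1 : C(X, G)).prodMk u) ((u.comp ContinuousMap.snd).prodMk F.toContinuousMap) fun x => by
        refine Prod.ext rfl ?_
        change (1 : G) • u x = F (0, x)
        rw [one_smul, F.apply_zero]
    let v' : C(X, G) := ⟨fun x => (L (1, x)).1, by fun_prop⟩
    have hv' : HClass.mk v' = 1 := by
      refine (HClass.mk_eq_mk.2
        ⟨⟨⟨fun y => (L y).1, by fun_prop⟩, fun x => ?_, fun x => rfl⟩⟩ : HClass.mk 1 = _).symm
      exact congrArg Prod.fst (hL0 x)
    have hsm : ∀ x, v' x • u x = v x • u x := fun x => by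
      have h1 : (L (1, x)).2 = u x := congrArg Prod.fst (hL (1, x))
      have h2 : (L (1, x)).1 • (L (1, x)).2 = F (1, x) := congrArg Prod.snd (hL (1, x))
      rw [h1, F.apply_one] at h2
      exact h2
    obtain ⟨t, ht⟩ := hT.exists_kappa_eq u (v'⁻¹ * v) fun x => by
      change ((v' x)⁻¹ * v x) • u x = u x
      rw [mul_smul, ← hsm, inv_smul_smul]
    refine ⟨HClass.mk t, ?_⟩
    change HClass.mk ((kappa T).comp (u.prodMk t)) = _
    rw [ht]
    change (HClass.mk v')⁻¹ * HClass.mk v = _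
    rw [hv', inv_one, one_mul]

end Exactness

end BundleSeq

end

theorem theorem3 {G : Type*} [Group G] [TopologicalSpace G] [IsTopologicalGroup G]
    (T : Subgroup G) (hT : IsClosed (T : Set G)) [IsMulCommutative T]
    {X : Type*} [TopologicalSpace X] [T2Space X] [Topology.CWComplex (Set.univ : Set X)]
    (e : BundleSeq.MilnorE G) :
    -- a map `X → BT` lifts to `G/T` up to homotopy iff its composite to `BG` is null-homotopic
    (∀ f : C(X, BundleSeq.SubgroupB T),
      (∃ u : C(X, G ⧸ T), ((BundleSeq.fibreIncl T e).comp u).Homotopic f) ↔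
        ((BundleSeq.projB T).comp f).Nullhomotopic) ∧
    -- the orbits of `[X, G]` on `[X, G/T]` are exactly the fibres of `h`
    (∀ y : BundleSeq.HClass X (G ⧸ T),
      MulAction.orbit (BundleSeq.HClass X G) y =
        {y' | BundleSeq.HClass.postcomp (BundleSeq.fibreIncl T e) y' =
          BundleSeq.HClass.postcomp (BundleSeq.fibreIncl T e) y}) ∧
    -- the image of `κ_u` lies in the stabilizer of `u`
    (∀ u : C(X, G ⧸ T), (BundleSeq.kappaHom T u).range ≤
      MulAction.stabilizer (BundleSeq.HClass X G) (BundleSeq.HClass.mk u)) ∧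
    -- and is all of it when `G → G/T` is a principal `T`-bundle
    (BundleSeq.HasLocalCrossSections T → ∀ u : C(X, G ⧸ T),
      MulAction.stabilizer (BundleSeq.HClass X G) (BundleSeq.HClass.mk u) =
        (BundleSeq.kappaHom T u).range) := by
  exact ⟨BundleSeq.exists_lift_iff_nullhomotopic T e, BundleSeq.orbit_eq_fibre T e,
    BundleSeq.range_kappaHom_le_stabilizer T, fun h u =>
      le_antisymm (BundleSeq.stabilizer_le_range_kappaHom T h u)
        (BundleSeq.range_kappaHom_le_stabilizer T u)⟩
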